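/- All quantum systems are finite-dimensional. Let $\Theta\subseteq\mathbb{R}^D$ be open and let $\{\mathcal{N}^{\boldsymbol\theta}_{A\to B}\}_{\boldsymbol\theta\in\Theta}$ be a differentiable family of quantum channels (completely positive trace-preserving maps whose first partial derivatives in $\theta_1,\dots,\theta_D$ exist on $\Theta$). Let $W$ be a $D\times D$ positive semidefinite (possibly complex) matrix with $\operatorname{Tr}[W]=1$, and let $n\ge 1$. *RLD Fisher information value.* For a family $\{\rho_{\boldsymbol\theta}\}$ of positive semidefinite matrices with first partial derivatives, let $\rho_{\boldsymbol\theta}^{-1}$ be the inverse on the support, $\Pi^\perp_{\rho_{\boldsymbol\theta}}$ the projection onto the kernel, and call $$\Big[\sum_{j,k=1}^D\langle k|W|j\rangle(\partial_{\theta_k}\rho_{\boldsymbol\theta})(\partial_{\theta_j}\rho_{\boldsymbol\theta})\Big]\Pi^\perp_{\rho_{\boldsymbol\theta}}=0$$ the finiteness condition. For a state family put $$\widehat I_F(\boldsymbol\theta,W;\{\rho_{\boldsymbol\theta}\}_{\boldsymbol\theta})=\sum_{j,k=1}^D\langle k|W|j\rangle\operatorname{Tr}[(\partial_{\theta_j}\rho_{\boldsymbol\theta})\rho_{\boldsymbol\theta}^{-1}(\partial_{\theta_k}\rho_{\boldsymbol\theta})]$$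 if the finiteness condition holds, and $+\infty$ otherwise. For the channel family put $$\widehat I_F(\boldsymbol\theta,W;\{\mathcal N^{\boldsymbol\theta}_{A\to B}\}_{\boldsymbol\theta})=\sup_{\rho_{RA}}\widehat I_F(\boldsymbol\theta,W;\{\mathcal N^{\boldsymbol\theta}_{A\to B}(\rho_{RA})\}_{\boldsymbol\theta}),$$ the supremum being over all states $\rho_{RA}$ with $R$ of arbitrary finite dimension, if the Choi operators $\Gamma^{\mathcal N^{\boldsymbol\theta}}_{RB}=\mathcal N^{\boldsymbol\theta}_{A\to B}\big(\sum_{i,j}|i\rangle\langle j|_R\otimes|i\rangle\langle j|_A\big)$ satisfy the finiteness condition, and $+\infty$ otherwise. *Sequential protocol.* An $n$-round sequential (adaptive) protocol consists of a state $\rho_{R_1A_1}$, channels $\mathcal S^i_{R_iB_i\to R_{i+1}A_{i+1}}$ for $1\le i\le n-1$, and a POVM $\Lambda$ on $R_nB_n$ with outcomes $\widehat{\boldsymbol\theta}\in\mathbb R^D$, none of them depending on $\boldsymbol\theta$. The final state is $$\omega^{\boldsymbol\theta}_{R_nB_n}=(\mathcal N^{\boldsymbol\theta}_{A_n\to B_n}\circ\mathcal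 S^{n-1}\circ\cdots\circ\mathcal S^1\circ\mathcal N^{\boldsymbol\theta}_{A_1\to B_1})(\rho_{R_1A_1}),$$ and the estimate $\widehat{\boldsymbol\theta}$ has the law $\operatorname{Tr}[\Lambda(\cdot)\,\omega^{\boldsymbol\theta}_{R_nB_n}]$. **Theorem.** Suppose that the estimate is unbiased, i.e. $\mathbb E_{\boldsymbol\theta}[\widehat{\boldsymbol\theta}]=\boldsymbol\theta$ for every $\boldsymbol\theta\in\Theta$. Then at every $\boldsymbol\theta\in\Theta$ at which $\widehat{\boldsymbol\theta}$ has finite second moments, the covariance matrix $\operatorname{Cov}(\boldsymbol\theta)=\mathbb E_{\boldsymbol\theta}[(\widehat{\boldsymbol\theta}-\boldsymbol\theta)(\widehat{\boldsymbol\theta}-\boldsymbol\theta)^T]$ satisfies $$\operatorname{Tr}[W\operatorname{Cov}(\boldsymbol\theta)]\ \ge\ \frac{1}{n\,\widehat I_F(\boldsymbol\theta,W;\{\mathcal N^{\boldsymbol\theta}_{A\to B}\}_{\boldsymbol\theta})},$$ where $1/\infty=0$ and $1/0=\infty$ (so no such protocol exists when the value is $0$). -/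

import Mathlib

open MeasureTheory
open scoped ENNReal ComplexOrder

namespace QuantumEstimation

/-! Finite-dimensional quantum systems are given by finite index types (an orthonormal basis);
operators are complex matrices.  A composite system `R A` has index type `R × A`. -/

/-- Quantum states: positive semidefinite matrices of unit trace. -/
structure DensityMatrix (m : Type*) [Fintype m] where
  mat : Matrix m m ℂ
  posSemidef : mat.PosSemidef
  trace_eq_one : mat.trace = 1

/-- The map `id_R ⊗ N`, applied to an operator on `R A`: it acts by `N` on every `A`-block. -/
def ampliate {R A B : Type*} (N : Matrix A A ℂ →ₗ[ℂ] Matrix B B ℂ)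
    (X : Matrix (R × A) (R × A) ℂ) : Matrix (R × B) (R × B) ℂ :=
  Matrix.of fun p q => N (X.submatrix (fun a => (p.1, a)) (fun a => (q.1, a))) p.2 q.2

/-- Quantum channels: completely positive trace-preserving linear maps. -/
structure QuantumChannel (A B : Type*) [Fintype A] [Fintype B] where
  map : Matrix A A ℂ →ₗ[ℂ] Matrix B B ℂ
  completelyPositive : ∀ (k : ℕ) (X : Matrix (Fin k × A) (Fin k × A) ℂ),
    X.PosSemidef → (ampliate map X).PosSemidef
  tracePreserving : ∀ X : Matrix A A ℂ, (map X).trace = X.trace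

namespace QuantumChannel

variable {A B : Type*} [Fintype A] [Fintype B]

theorem map_posSemidef (N : QuantumChannel A B) {X : Matrix A A ℂ} (hX : X.PosSemidef) :
    (N.map X).PosSemidef := by
  have h := N.completelyPositive 1 (X.submatrix Prod.snd Prod.snd) (hX.submatrix _)
  exact h.submatrix (fun b : B => ((0 : Fin 1), b))

theorem trace_ampliate (N : QuantumChannel A B) {k : ℕ}
    (X : Matrix (Fin k × A) (Fin k × A) ℂ) : (ampliate N.map X).trace = X.trace := by
  have h : ∀ r : Fin k, ∑ b, N.map (X.submatrix (fun a => (r, a)) (fun a => (r, a))) b b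
      = ∑ a, X (r, a) (r, a) := fun r => N.tracePreserving _
  simp only [Matrix.trace, Matrix.diag_apply, Fintype.sum_prod_type, ampliate, Matrix.of_apply]
  exact Finset.sum_congr rfl fun r _ => h r

/-- The output state of a channel. -/
def apply (N : QuantumChannel A B) (ρ : DensityMatrix A) : DensityMatrix B where
  mat := N.map ρ.mat
  posSemidef := N.map_posSemidef ρ.posSemidef
  trace_eq_one := (N.tracePreserving _).trans ρ.trace_eq_one

/-- The output state `N_{A → B}(ρ_{RA})`, the channel acting on the second subsystem. -/
def applySnd (N : QuantumChannel A B) {r : ℕ} (ρ : DensityMatrix (Fin r × A)) :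
    DensityMatrix (Fin r × B) where
  mat := ampliate N.map ρ.mat
  posSemidef := N.completelyPositive r _ ρ.posSemidef
  trace_eq_one := (N.trace_ampliate _).trans ρ.trace_eq_one

/-- The Choi operator `(id ⊗ N)(|Γ⟩⟨Γ|)`, where `|Γ⟩ = ∑ i, |i⟩|i⟩` is unnormalized. -/
def choi [DecidableEq A] (N : QuantumChannel A B) : Matrix (A × B) (A × B) ℂ :=
  ampliate N.map
    (Matrix.of fun p q : A × A => if p.1 = p.2 ∧ q.1 = q.2 then (1 : ℂ) else 0)

end QuantumChannel

/-- The partial derivative `∂_{θ_j} M_θ` of a matrix family (taken entrywise). -/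
noncomputable def partialDeriv {D : ℕ} {m : Type*} (M : (Fin D → ℝ) → Matrix m m ℂ)
    (θ : Fin D → ℝ) (j : Fin D) : Matrix m m ℂ :=
  Matrix.of fun a b => lineDeriv ℝ (fun ϑ => M ϑ a b) θ (Pi.single j 1)

/-- A channel family is differentiable on `Θ` if the outputs on every fixed input have all first
partial derivatives at every point of `Θ`. -/
def IsDifferentiableFamily {D : ℕ} {A B : Type*} [Fintype A] [Fintype B] (Θ : Set (Fin D → ℝ))
    (N : (Fin D → ℝ) → QuantumChannel A B) : Prop :=
  ∀ θ ∈ Θ, ∀ (j : Fin D) (X : Matrix A A ℂ) (b b' : B),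
    LineDifferentiableAt ℝ (fun ϑ => (N ϑ).map X b b') θ (Pi.single j 1)

section Fisher

variable {D : ℕ} {m : Type*} [Fintype m] [DecidableEq m]

/-- The inverse of a Hermitian matrix taken on its support (`x ↦ x⁻¹` sends `0` to `0`). -/
noncomputable def supportInv (ρ : Matrix m m ℂ) : Matrix m m ℂ :=
  cfc (fun x : ℝ => x⁻¹) ρ

/-- The orthogonal projection onto the kernel of a Hermitian matrix. -/
noncomputable def kernelProj (ρ : Matrix m m ℂ) : Matrix m m ℂ :=
  cfc (fun x : ℝ => if x = 0 then (1 : ℝ) else 0) ρ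

/-- The matrix with entries `Tr[(∂_j ρ) ρ⁻¹ (∂_k ρ)]`. -/
noncomputable def rldMatrix (ρ : (Fin D → ℝ) → Matrix m m ℂ) (θ : Fin D → ℝ) :
    Matrix (Fin D) (Fin D) ℂ :=
  Matrix.of fun j k =>
    (partialDeriv ρ θ j * supportInv (ρ θ) * partialDeriv ρ θ k).trace

/-- The finiteness condition `[∑_{j,k} ⟨k|W|j⟩ (∂_k ρ)(∂_j ρ)] Π^⊥ = 0`, with `Π^⊥` the
projection onto the kernel of `ρ`. -/
def RLDFinite (W : Matrix (Fin D) (Fin D) ℂ) (ρ : (Fin D → ℝ) → Matrix m m ℂ)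
    (θ : Fin D → ℝ) : Prop :=
  (∑ j, ∑ k, W k j • (partialDeriv ρ θ k * partialDeriv ρ θ j)) * kernelProj (ρ θ) = 0

open Classical in
/-- The RLD Fisher information value of a state family: `Tr[W Î_F]` (a nonnegative real number
for positive semidefinite `W` and `ρ θ`) if the finiteness condition holds, and `+∞` otherwise. -/
noncomputable def rldValueState (W : Matrix (Fin D) (Fin D) ℂ)
    (ρ : (Fin D → ℝ) → Matrix m m ℂ) (θ : Fin D → ℝ) : ℝ≥0∞ :=
  if RLDFinite W ρ θ then ENNReal.ofReal (W * rldMatrix ρ θ).trace.re else ⊤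

open Classical in
/-- The RLD Fisher information value of a channel family: if the Choi operators satisfy the
finiteness condition, the supremum over all input states `ρ_{RA}` with a reference system `R` of
arbitrary finite dimension; otherwise `+∞`. -/
noncomputable def rldValueChannel {A B : Type*} [Fintype A] [DecidableEq A] [Fintype B]
    [DecidableEq B] (W : Matrix (Fin D) (Fin D) ℂ) (N : (Fin D → ℝ) → QuantumChannel A B)
    (θ : Fin D → ℝ) : ℝ≥0∞ :=
  if RLDFinite W (fun ϑ => (N ϑ).choi) θ then
    ⨆ (r : ℕ) (ρ : DensityMatrix (Fin r × A)),
      rldValueState W (fun ϑ => ((N ϑ).applySnd ρ).mat) θ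
  else ⊤

end Fisher

/-- Sequential (adaptive) schemes: `SequentialScheme A B n r` makes `n ≥ 1` calls to an unknown
channel from `A` to `B` and ends with a memory system `R_n` of dimension `r`.  A scheme starts
with an input state of `R_1 A_1`, which is followed by the first channel use; each further
channel use is preceded by an interleaving channel from `R_i B_i` to `R_{i+1} A_{i+1}`. -/
inductive SequentialScheme (A B : Type*) [Fintype A] [Fintype B] : ℕ → ℕ → Type _
  | first {r : ℕ} (ρ : DensityMatrix (Fin r × A)) : SequentialScheme A B 1 r
  | next {n r r' : ℕ} (P : SequentialScheme A B n r)
      (S : QuantumChannel (Fin r × B) (Fin r' × A)) : SequentialScheme A B (n + 1) r'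

/-- The final state of `R_n B_n` when the scheme is run with the channel `N`. -/
def SequentialScheme.finalState {A B : Type*} [Fintype A] [Fintype B] (N : QuantumChannel A B) :
    {n r : ℕ} → SequentialScheme A B n r → DensityMatrix (Fin r × B)
  | _, _, .first ρ => N.applySnd ρ
  | _, _, .next P S => N.applySnd (S.apply (P.finalState N))

/-- Positive operator-valued measures with outcomes in a measurable space `Ω`. -/
structure POVM (m Ω : Type*) [Fintype m] [DecidableEq m] [MeasurableSpace Ω] where
  effect : VectorMeasure Ω (Matrix m m ℂ)
  posSemidef : ∀ s : Set Ω, MeasurableSet s → (effect s).PosSemidef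
  effect_univ : effect Set.univ = 1

section Born

theorem trace_mul_nonneg {m : Type*} [Fintype m] {X Y : Matrix m m ℂ} (hX : X.PosSemidef) (hY : Y.PosSemidef) :
    0 ≤ (X * Y).trace.re := by
  obtain ⟨k, v, rfl⟩ := Matrix.posSemidef_iff_eq_sum_vecMulVec.mp hY
  rw [Matrix.mul_sum, Matrix.trace_sum, Complex.re_sum]
  refine Finset.sum_nonneg fun i _ => ?_
  rw [Matrix.mul_vecMulVec, Matrix.trace_vecMulVec, dotProduct_comm]
  exact hX.re_dotProduct_nonneg (v i)

variable {m Ω : Type*} [Fintype m] [DecidableEq m] [MeasurableSpace Ω]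

/-- The outcome distribution `s ↦ Tr[Λ(s) ρ]` of a measurement (Born rule). -/
noncomputable def POVM.outcome (M : POVM m Ω) (ρ : DensityMatrix m) : Measure Ω :=
  Measure.ofMeasurable (fun s _ => ENNReal.ofReal (M.effect s * ρ.mat).trace.re)
    (by simp)
    (by
      intro f hf hd
      have h1 := M.effect.hasSum_of_disjoint_iUnion hf hd
      let L : Matrix m m ℂ →+ ℝ :=
        { toFun := fun X => (X * ρ.mat).trace.re
          map_zero' := by simp
          map_add' := fun X Y => by simp [Matrix.add_mul] }
      have hL : Continuous L := by
        change Continuous fun X : Matrix m m ℂ => (X * ρ.mat).trace.re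
        fun_prop
      have h2 := h1.map L hL
      have h3 : ∀ i, 0 ≤ L (M.effect (f i)) := fun i =>
        trace_mul_nonneg (M.posSemidef _ (hf i)) ρ.posSemidef
      have h4 := ENNReal.ofReal_tsum_of_nonneg h3 h2.summable
      have h5 : ∑' i, L (M.effect (f i)) = L (M.effect (⋃ i, f i)) := h2.tsum_eq
      rw [h5] at h4
      exact h4)

theorem POVM.outcome_apply (M : POVM m Ω) (ρ : DensityMatrix m) {s : Set Ω}
    (hs : MeasurableSet s) :
    M.outcome ρ s = ENNReal.ofReal (M.effect s * ρ.mat).trace.re :=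
  Measure.ofMeasurable_apply s hs

end Born

/-- A measurement whose outcome is an estimate of `θ ∈ ℝ^D`, with outcome distribution `P ϑ` when
the true parameter is `ϑ`, is unbiased on `Θ` if the estimate has mean `ϑ` for every `ϑ ∈ Θ`. -/
def IsUnbiased {D : ℕ} (Θ : Set (Fin D → ℝ)) (P : (Fin D → ℝ) → Measure (Fin D → ℝ)) : Prop :=
  ∀ ϑ ∈ Θ, ∀ i, Integrable (fun x => x i) (P ϑ) ∧ ∫ x, x i ∂(P ϑ) = ϑ i

/-- The covariance matrix `E[(θ̂ - θ)(θ̂ - θ)^T]`. -/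
noncomputable def covMatrix {D : ℕ} (P : Measure (Fin D → ℝ)) (θ : Fin D → ℝ) :
    Matrix (Fin D) (Fin D) ℝ :=
  Matrix.of fun i j => ∫ x, (x i - θ i) * (x j - θ j) ∂P

end QuantumEstimation

/-!
Write `W = C Cᴴ` and let `X l = ∑ k, C k l ∂_k ρ` be the complex directional derivative along the
`l`-th column of `C`.  The finiteness condition says that the range of each `X l` lies in the
support of `ρ`, and the RLD value is `∑ l, Tr[(X l)ᴴ ρ⁻¹ X l]`.  Both facts together are encoded
without inverses by `Dominated ρ X c`: some positive semidefinite block matrix has first row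
`ρ, X 0, X 1, …` and remaining diagonal blocks of total trace at most `c`.  If
`ρ = U Uᴴ` and `X l = U (V l)ᴴ` is a factorization of such a matrix, then `∑ l, Tr[V l (V l)ᴴ] ≤ c`.

*Sequential schemes.*  A fixed channel applied to every block preserves `Dominated`
(`Dominated.map`).  A use of the unknown channel, with Choi matrix `Γ = H Hᴴ` and directional
derivatives `M l = H (G l)ᴴ`, acts on factorizations by the Leibniz rule.  The traces of the cross
terms are traces of outputs of the derivative of a trace-preserving map, so they vanish, and
the cost grows only by the expectation of `(M l)ᴴ Γ⁻¹ M l` in the input (`Dominated.choiAct`).  That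
expectation is at most the channel value `v`: for a purification with invertible amplitude matrix
`K` the output family is the congruence of `Γ` and `M l` by `K ⊗ 1`, which leaves the quadratic form
covariant (`congruence_supportInv`), and the other inputs follow by a limit
(`sum_trace_choiAct_le`).  Hence the final state after `n` uses is dominated by `n v`
(`SequentialScheme.finalState_dominated`).

*Cramér–Rao.*  The derivative of the pair `(ρ ϑ, ϑ)` lies in the linear span of its values, so
unbiasedness passes to derivatives without differentiating under the integral sign.  With the
estimate discretized by simple functions, the Cauchy–Schwarz inequality for factorizations and
Kadison's inequality `Tᴴ T ≤ ∑ y, |f y|² E y` for `T = ∑ y, f y • E y` bound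
`∑ l, ∑ y, f l y Tr[E y X l]`.  Refining the discretization, this quantity tends to `Tr W = 1`, and
the inequality becomes `1 ≤ Tr[W Cov] · c` (`one_le_trace_mul_covMatrix_mul`).
-/

namespace QuantumEstimation
open Matrix
open scoped Kronecker

/-! ### Inverses on the support -/

section Pseudoinverse

variable {m : Type*} [Fintype m] [DecidableEq m] {ρ : Matrix m m ℂ}

theorem continuousOn_spectrum (ρ : Matrix m m ℂ) (f : ℝ → ℝ) :
    ContinuousOn f (spectrum ℝ ρ) :=
  ρ.finite_real_spectrum.continuousOn f

theorem supportInv_isHermitian (ρ : Matrix m m ℂ) : (supportInv ρ).IsHermitian :=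
  cfc_predicate (p := IsSelfAdjoint) (fun x : ℝ => x⁻¹) ρ

theorem kernelProj_isHermitian (ρ : Matrix m m ℂ) : (kernelProj ρ).IsHermitian :=
  cfc_predicate (p := IsSelfAdjoint) (fun x : ℝ => if x = 0 then (1 : ℝ) else 0) ρ

theorem mul_supportInv (h : ρ.IsHermitian) : ρ * supportInv ρ = 1 - kernelProj ρ := by
  have hs : IsSelfAdjoint ρ := h
  have h1 : ρ * supportInv ρ = cfc (fun x : ℝ => x * x⁻¹) ρ := by
    rw [cfc_mul (fun x : ℝ => x) _ ρ (continuousOn_spectrum _ _) (continuousOn_spectrum _ _),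
      cfc_id' ℝ ρ, supportInv]
  have h2 : (1 : Matrix m m ℂ) - kernelProj ρ
      = cfc (fun x : ℝ => 1 - if x = 0 then (1 : ℝ) else 0) ρ := by
    rw [cfc_sub (fun _ : ℝ => (1 : ℝ)) _ ρ (continuousOn_spectrum _ _)
      (continuousOn_spectrum _ _), cfc_const_one ℝ ρ, kernelProj]
  rw [h1, h2]
  congr 1
  ext x
  by_cases hx : x = 0 <;> simp [hx]

theorem mul_supportInv_mul_self (h : ρ.IsHermitian) : ρ * supportInv ρ * ρ = ρ := by
  have hs : IsSelfAdjoint ρ := h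
  conv_rhs => rw [← cfc_id' ℝ ρ]
  have h1 : ρ * supportInv ρ * ρ = cfc (fun x : ℝ => x * x⁻¹ * x) ρ := by
    rw [cfc_mul (fun x : ℝ => x * x⁻¹) (fun x : ℝ => x) ρ (continuousOn_spectrum _ _)
      (continuousOn_spectrum _ _),
      cfc_mul (fun x : ℝ => x) _ ρ (continuousOn_spectrum _ _) (continuousOn_spectrum _ _),
      cfc_id' ℝ ρ, supportInv]
  rw [h1]
  congr 1
  ext x
  exact mul_inv_mul_cancel x

theorem supportInv_mul_mul_supportInv (h : ρ.IsHermitian) :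
    supportInv ρ * ρ * supportInv ρ = supportInv ρ := by
  have hs : IsSelfAdjoint ρ := h
  have h1 : supportInv ρ * ρ * supportInv ρ = cfc (fun x : ℝ => x⁻¹ * x * x⁻¹) ρ := by
    rw [cfc_mul (fun x : ℝ => x⁻¹ * x) (fun x : ℝ => x⁻¹) ρ (continuousOn_spectrum _ _)
      (continuousOn_spectrum _ _),
      cfc_mul (fun x : ℝ => x⁻¹) (fun x : ℝ => x) ρ (continuousOn_spectrum _ _)
        (continuousOn_spectrum _ _),
      cfc_id' ℝ ρ, supportInv]
  rw [h1, supportInv]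
  congr 1
  ext x
  by_cases hx : x = 0 <;> simp [hx]

open scoped MatrixOrder in
theorem exists_eq_mul_conjTranspose (hρ : ρ.PosSemidef) : ∃ F : Matrix m m ℂ, ρ = F * Fᴴ := by
  obtain ⟨F, hF⟩ := CStarAlgebra.nonneg_iff_eq_star_mul_self.mp hρ.nonneg
  exact ⟨Fᴴ, by rw [hF, conjTranspose_conjTranspose, star_eq_conjTranspose]⟩

end Pseudoinverse

/-! ### The RLD value as a sum over complex directions -/

section Directions

variable {D : ℕ} {m : Type*}

/-- The complex directional derivative `∑ k, C k l ∂_k` attached to the `l`-th column of `C`,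
evaluated on a given family of partial derivatives `X k`. -/
noncomputable def combine (C : Matrix (Fin D) (Fin D) ℂ) (X : Fin D → Matrix m m ℂ)
    (l : Fin D) : Matrix m m ℂ :=
  ∑ k, C k l • X k

theorem conjTranspose_combine (C : Matrix (Fin D) (Fin D) ℂ) {X : Fin D → Matrix m m ℂ}
    (hX : ∀ k, (X k).IsHermitian) (l : Fin D) :
    (combine C X l)ᴴ = ∑ j, star (C j l) • X j := by
  simp only [combine, conjTranspose_sum, conjTranspose_smul]
  exact Finset.sum_congr rfl fun j _ => by rw [(hX j).eq]

/-- Sums weighted by `C * Cᴴ` split into one rank-one sum for each column of `C`. -/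
theorem sum_mul_conjTranspose_smul {E : Type*} [AddCommMonoid E] [Module ℂ E]
    (C : Matrix (Fin D) (Fin D) ℂ) (F : Fin D → Fin D → E) :
    ∑ j, ∑ k, (C * Cᴴ) k j • F k j = ∑ l, ∑ j, ∑ k, (star (C j l) * C k l) • F k j := by
  simp only [mul_apply, conjTranspose_apply, Finset.sum_smul]
  rw [Finset.sum_comm' (s := Finset.univ (α := Fin D)) (t := fun _ => Finset.univ)
    (s' := fun _ => Finset.univ) (t' := Finset.univ (α := Fin D)) (by simp)]
  conv_rhs => rw [Finset.sum_comm]; enter [2, j]; rw [Finset.sum_comm]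
  rw [Finset.sum_comm]
  simp only [mul_comm]

variable [Fintype m] [DecidableEq m]

/-- The finiteness condition says that the range of each directional derivative lies in the
support of the state. -/
theorem mul_supportInv_mul_combine_of_rldFinite (C : Matrix (Fin D) (Fin D) ℂ)
    {ρ : (Fin D → ℝ) → Matrix m m ℂ} {θ : Fin D → ℝ} (hρ : (ρ θ).IsHermitian)
    (hX : ∀ k, (partialDeriv ρ θ k).IsHermitian) (hfin : RLDFinite (C * Cᴴ) ρ θ) (l : Fin D) :
    ρ θ * supportInv (ρ θ) * combine C (partialDeriv ρ θ) l
      = combine C (partialDeriv ρ θ) l := by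
  set X := combine C (partialDeriv ρ θ)
  set Q := kernelProj (ρ θ)
  have h1 : (∑ l, X l * (X l)ᴴ) * Q = 0 := by
    rw [← hfin, sum_mul_conjTranspose_smul]
    congr 1
    refine Finset.sum_congr rfl fun l _ => ?_
    rw [conjTranspose_combine C hX]
    simp only [X, combine, Finset.sum_mul, Finset.mul_sum, smul_mul_smul_comm]
    simp only [mul_comm]
  have h2 : ∑ l, ((Q * X l) * (Q * X l)ᴴ).trace = 0 := by
    have h3 : ∑ l, (Q * X l) * (Q * X l)ᴴ = Q * ((∑ l, X l * (X l)ᴴ) * Q) := by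
      simp only [Finset.sum_mul, Finset.mul_sum, conjTranspose_mul,
        (kernelProj_isHermitian (ρ θ)).eq, Matrix.mul_assoc, Q]
    rw [← trace_sum, h3, h1, Matrix.mul_zero, trace_zero]
  have h4 := (Finset.sum_eq_zero_iff_of_nonneg fun l _ =>
    (posSemidef_self_mul_conjTranspose (Q * X l)).trace_nonneg).mp h2 l (Finset.mem_univ l)
  rw [trace_mul_conjTranspose_self_eq_zero_iff] at h4
  rw [mul_supportInv hρ, Matrix.sub_mul, Matrix.one_mul, h4, sub_zero]

theorem trace_mul_rldMatrix (C : Matrix (Fin D) (Fin D) ℂ) {ρ : (Fin D → ℝ) → Matrix m m ℂ}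
    {θ : Fin D → ℝ} (hX : ∀ k, (partialDeriv ρ θ k).IsHermitian) :
    (C * Cᴴ * rldMatrix ρ θ).trace
      = ∑ l, ((combine C (partialDeriv ρ θ) l)ᴴ * supportInv (ρ θ)
          * combine C (partialDeriv ρ θ) l).trace := by
  have h1 : (C * Cᴴ * rldMatrix ρ θ).trace
      = ∑ j, ∑ k, (C * Cᴴ) k j •
          (partialDeriv ρ θ j * supportInv (ρ θ) * partialDeriv ρ θ k).trace := by
    rw [Finset.sum_comm]
    simp only [trace, diag_apply, mul_apply (M := C * Cᴴ), rldMatrix, of_apply, smul_eq_mul]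
  rw [h1, sum_mul_conjTranspose_smul]
  refine Finset.sum_congr rfl fun l _ => ?_
  rw [conjTranspose_combine C hX]
  simp only [combine, Finset.sum_mul, Finset.mul_sum, trace_sum, smul_mul_assoc, mul_smul_comm,
    trace_smul, mul_comm]
  rw [Finset.sum_comm]
  simp only [Finset.smul_sum, smul_smul]

/-- The quadratic form `X ↦ Xᴴ ρ⁻¹ X` is covariant under a congruence `ρ ↦ K ρ Kᴴ`,
`X ↦ K X Kᴴ` by a left invertible `K`, as long as the support condition holds. -/
theorem congruence_supportInv {n : Type*} [Fintype n] [DecidableEq n] {K : Matrix m n ℂ}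
    {J : Matrix n m ℂ} (hJK : J * K = 1) {Γ M : Matrix n n ℂ} (hΓ : Γ.IsHermitian)
    (hs : (K * Γ * Kᴴ) * supportInv (K * Γ * Kᴴ) * (K * M * Kᴴ) = K * M * Kᴴ) :
    (K * M * Kᴴ)ᴴ * supportInv (K * Γ * Kᴴ) * (K * M * Kᴴ)
      = K * (Mᴴ * supportInv Γ * M) * Kᴴ := by
  have hKJ : Kᴴ * Jᴴ = 1 := by rw [← conjTranspose_mul, hJK, conjTranspose_one]
  set R := supportInv (K * Γ * Kᴴ) with hR
  have hRh : Rᴴ = R := supportInv_isHermitian _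
  have hσ : (K * Γ * Kᴴ).IsHermitian := isHermitian_mul_mul_conjTranspose K hΓ
  -- The support condition for `K M Kᴴ` exhibits `M` as a multiple of `Γ`.
  set B := Kᴴ * R * (K * M * Kᴴ) * Jᴴ with hB
  have hM : M = Γ * B := by
    have h1 := congrArg (fun Z => J * Z * Jᴴ) hs
    calc M = (J * K) * M * (Kᴴ * Jᴴ) := by rw [hJK, hKJ, Matrix.one_mul, Matrix.mul_one]
      _ = J * (K * M * Kᴴ) * Jᴴ := by simp only [Matrix.mul_assoc]
      _ = J * (K * Γ * Kᴴ * R * (K * M * Kᴴ)) * Jᴴ := h1.symm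
      _ = (J * K) * (Γ * B) := by simp only [hB, Matrix.mul_assoc]
      _ = Γ * B := by rw [hJK, Matrix.one_mul]
  have h2 : Mᴴ * supportInv Γ * M = Bᴴ * Γ * B := by
    rw [hM, conjTranspose_mul, hΓ.eq]
    calc Bᴴ * Γ * supportInv Γ * (Γ * B) = Bᴴ * (Γ * supportInv Γ * Γ) * B := by
          simp only [Matrix.mul_assoc]
      _ = _ := by rw [mul_supportInv_mul_self hΓ]
  have hBK : B * Kᴴ = Kᴴ * R * (K * M * Kᴴ) * (K * J)ᴴ := by
    simp only [hB, Matrix.mul_assoc, conjTranspose_mul]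
  have hX : (K * M * Kᴴ) * (K * J)ᴴ = K * M * Kᴴ := by
    calc (K * M * Kᴴ) * (K * J)ᴴ = K * M * (Kᴴ * Jᴴ) * Kᴴ := by
          simp only [Matrix.mul_assoc, conjTranspose_mul]
      _ = _ := by rw [hKJ, Matrix.mul_one]
  have hBK' : B * Kᴴ = Kᴴ * R * (K * M * Kᴴ) := by
    rw [hBK, Matrix.mul_assoc, hX]
  have hKB : K * Bᴴ = (K * M * Kᴴ)ᴴ * R * K := by
    have := congrArg conjTranspose hBK'
    simpa only [conjTranspose_mul, conjTranspose_conjTranspose, hRh, Matrix.mul_assoc] using this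
  calc (K * M * Kᴴ)ᴴ * R * (K * M * Kᴴ)
      = (K * M * Kᴴ)ᴴ * (R * (K * Γ * Kᴴ) * R) * (K * M * Kᴴ) := by
        rw [hR, supportInv_mul_mul_supportInv hσ]
    _ = ((K * M * Kᴴ)ᴴ * R * K) * Γ * (Kᴴ * R * (K * M * Kᴴ)) := by
        simp only [Matrix.mul_assoc]
    _ = K * Bᴴ * Γ * (B * Kᴴ) := by rw [← hKB, ← hBK']
    _ = _ := by rw [h2]; simp only [Matrix.mul_assoc]

end Directions

/-! ### Choi matrices acting on bipartite operators -/

section Marginal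

variable {R A : Type*}

/-- The partial trace over the reference system. -/
def marginal [Fintype R] (X : Matrix (R × A) (R × A) ℂ) : Matrix A A ℂ :=
  Matrix.of fun a a' => ∑ r, X (r, a) (r, a')

theorem marginal_posSemidef [Fintype R] {X : Matrix (R × A) (R × A) ℂ} (hX : X.PosSemidef) :
    (marginal X).PosSemidef := by
  have h : marginal X = ∑ r, X.submatrix (fun a => (r, a)) (fun a => (r, a)) := by
    ext a a'
    simp [marginal, Matrix.sum_apply]
  rw [h]
  exact posSemidef_sum _ fun r _ => hX.submatrix _

/-- The unnormalized pure state with amplitudes `K r a`. -/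
def pureMatrix (K : Matrix R A ℂ) : Matrix (R × A) (R × A) ℂ :=
  Matrix.vecMulVec (fun p => K p.1 p.2) (fun p => star (K p.1 p.2))

theorem pureMatrix_posSemidef [Fintype R] [Fintype A] (K : Matrix R A ℂ) :
    (pureMatrix K).PosSemidef :=
  posSemidef_vecMulVec_self_star _

theorem marginal_pureMatrix [Fintype R] (K : Matrix R A ℂ) :
    marginal (pureMatrix K) = Kᵀ * Kᵀᴴ := by
  ext a a'
  simp [marginal, pureMatrix, vecMulVec_apply, mul_apply]

end Marginal

section ChoiAction

variable {R A B : Type*} [Fintype A]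

/-- The action `id_R ⊗ N` on operators on `R A` of the linear map `N` whose Choi matrix is `J`. -/
def choiAct (J : Matrix (A × B) (A × B) ℂ) (X : Matrix (R × A) (R × A) ℂ) :
    Matrix (R × B) (R × B) ℂ :=
  Matrix.of fun p q => ∑ a, ∑ a', X (p.1, a) (q.1, a') * J (a, p.2) (a', q.2)

/-- The action on `R A` of the operators `A → B` whose vectorizations are the columns of `H`,
applied to all columns of `U`. -/
def krausAct {κ ι : Type*} (H : Matrix (A × B) κ ℂ) (U : Matrix (R × A) ι ℂ) :
    Matrix (R × B) (κ × ι) ℂ :=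
  Matrix.of fun p x => ∑ a, H (a, p.2) x.1 * U (p.1, a) x.2

theorem choiAct_mul_conjTranspose {κ ι : Type*} [Fintype κ] [Fintype ι]
    (H G : Matrix (A × B) κ ℂ) (U V : Matrix (R × A) ι ℂ) :
    choiAct (H * Gᴴ) (U * Vᴴ) = krausAct H U * (krausAct G V)ᴴ := by
  ext p q
  simp only [choiAct, krausAct, of_apply, mul_apply, conjTranspose_apply, Fintype.sum_prod_type,
    star_sum, star_mul', Finset.sum_mul_sum]
  calc _ = ∑ a, ∑ a', ∑ y, ∑ x,
        U (p.1, a) y * star (V (q.1, a') y) * (H (a, p.2) x * star (G (a', q.2) x)) := rfl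
    _ = ∑ a, ∑ a', ∑ x, ∑ y,
        U (p.1, a) y * star (V (q.1, a') y) * (H (a, p.2) x * star (G (a', q.2) x)) :=
      Finset.sum_congr rfl fun a _ => Finset.sum_congr rfl fun a' _ => Finset.sum_comm
    _ = ∑ a, ∑ x, ∑ a', ∑ y,
        U (p.1, a) y * star (V (q.1, a') y) * (H (a, p.2) x * star (G (a', q.2) x)) :=
      Finset.sum_congr rfl fun a _ => Finset.sum_comm
    _ = ∑ x, ∑ a, ∑ a', ∑ y,
        U (p.1, a) y * star (V (q.1, a') y) * (H (a, p.2) x * star (G (a', q.2) x)) :=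
      Finset.sum_comm
    _ = ∑ x, ∑ a, ∑ y, ∑ a',
        U (p.1, a) y * star (V (q.1, a') y) * (H (a, p.2) x * star (G (a', q.2) x)) :=
      Finset.sum_congr rfl fun x _ => Finset.sum_congr rfl fun a _ => Finset.sum_comm
    _ = ∑ x, ∑ y, ∑ a, ∑ a',
        U (p.1, a) y * star (V (q.1, a') y) * (H (a, p.2) x * star (G (a', q.2) x)) :=
      Finset.sum_congr rfl fun x _ => Finset.sum_comm
    _ = _ := by
      refine Finset.sum_congr rfl fun x _ => Finset.sum_congr rfl fun y _ =>
        Finset.sum_congr rfl fun a _ => Finset.sum_congr rfl fun a' _ => ?_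
      ring

theorem choiAct_zero (J : Matrix (A × B) (A × B) ℂ) :
    choiAct J (0 : Matrix (R × A) (R × A) ℂ) = 0 := by
  ext p q
  simp [choiAct]

theorem choiAct_combine_add {D : ℕ} (C : Matrix (Fin D) (Fin D) ℂ)
    (Γ : Matrix (A × B) (A × B) ℂ) (M : Fin D → Matrix (A × B) (A × B) ℂ)
    (ρ : Matrix (R × A) (R × A) ℂ) (X : Fin D → Matrix (R × A) (R × A) ℂ) (l : Fin D) :
    combine C (fun k => choiAct Γ (X k) + choiAct (M k) ρ) l
      = choiAct Γ (combine C X l) + choiAct (combine C M l) ρ := by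
  ext p q
  simp only [combine, choiAct, Matrix.sum_apply, Matrix.smul_apply, Matrix.add_apply, of_apply,
    smul_eq_mul, Finset.sum_mul, Finset.mul_sum, mul_add, Finset.sum_add_distrib]
  congr 1
  · rw [Finset.sum_comm]
    refine Finset.sum_congr rfl fun a _ => ?_
    rw [Finset.sum_comm]
    exact Finset.sum_congr rfl fun a _ => Finset.sum_congr rfl fun k _ => by ring
  · rw [Finset.sum_comm]
    refine Finset.sum_congr rfl fun a _ => ?_
    rw [Finset.sum_comm]
    exact Finset.sum_congr rfl fun a _ => Finset.sum_congr rfl fun k _ => by ring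

theorem trace_choiAct [Fintype R] [Fintype B] (J : Matrix (A × B) (A × B) ℂ)
    (X : Matrix (R × A) (R × A) ℂ) :
    (choiAct J X).trace = ∑ a, ∑ a', marginal X a a' * ∑ b, J (a, b) (a', b) := by
  simp only [trace, diag_apply, choiAct, of_apply, marginal, Fintype.sum_prod_type,
    Finset.sum_mul_sum]
  calc _ = ∑ r, ∑ b, ∑ a, ∑ a', X (r, a) (r, a') * J (a, b) (a', b) := rfl
    _ = ∑ r, ∑ a, ∑ b, ∑ a', X (r, a) (r, a') * J (a, b) (a', b) :=
      Finset.sum_congr rfl fun r _ => Finset.sum_comm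
    _ = ∑ a, ∑ r, ∑ b, ∑ a', X (r, a) (r, a') * J (a, b) (a', b) := Finset.sum_comm
    _ = ∑ a, ∑ r, ∑ a', ∑ b, X (r, a) (r, a') * J (a, b) (a', b) :=
      Finset.sum_congr rfl fun a _ => Finset.sum_congr rfl fun r _ => Finset.sum_comm
    _ = _ := Finset.sum_congr rfl fun a _ => Finset.sum_comm

theorem ampliate_eq_choiAct [DecidableEq A] [Fintype B] (N : QuantumChannel A B)
    (X : Matrix (R × A) (R × A) ℂ) : ampliate N.map X = choiAct N.choi X := by
  ext p q
  have hc : ∀ a a' : A, N.map (Matrix.single a a' 1) p.2 q.2 = N.choi (a, p.2) (a', q.2) := by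
    intro a a'
    simp only [QuantumChannel.choi, ampliate, of_apply]
    congr 2
  simp only [ampliate, choiAct, of_apply, ← hc]
  conv_lhs =>
    rw [matrix_eq_sum_single (X.submatrix (fun a => (p.1, a)) (fun a => (q.1, a)))]
  simp only [map_sum, Matrix.sum_apply, submatrix_apply]
  refine Finset.sum_congr rfl fun a _ => Finset.sum_congr rfl fun a' _ => ?_
  change N.map (single a a' (X (p.1, a) (q.1, a'))) p.2 q.2 = _
  have h : single a a' (X (p.1, a) (q.1, a')) = X (p.1, a) (q.1, a') • single a a' (1 : ℂ) := by
    rw [smul_single, smul_eq_mul, mul_one]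
  rw [h, map_smul, Matrix.smul_apply, smul_eq_mul]

theorem trace_marginal [Fintype R] (X : Matrix (R × A) (R × A) ℂ) :
    (marginal X).trace = X.trace := by
  simp only [trace, diag_apply, marginal, of_apply, Fintype.sum_prod_type]
  exact Finset.sum_comm

theorem choiAct_pureMatrix [Fintype B] [DecidableEq B] (J : Matrix (A × B) (A × B) ℂ)
    (K : Matrix R A ℂ) :
    choiAct J (pureMatrix K) = (K ⊗ₖ (1 : Matrix B B ℂ)) * J * (K ⊗ₖ (1 : Matrix B B ℂ))ᴴ := by
  ext p q
  simp only [choiAct, pureMatrix, vecMulVec_apply, of_apply, mul_apply, kroneckerMap_apply,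
    conjTranspose_apply, Fintype.sum_prod_type, one_apply]
  simp only [mul_ite, mul_one, mul_zero, ite_mul, zero_mul, Finset.sum_ite_eq, Finset.mem_univ,
    if_true, apply_ite star, star_zero, Finset.sum_mul]
  rw [Finset.sum_comm]
  refine Finset.sum_congr rfl fun a' _ => Finset.sum_congr rfl fun a _ => ?_
  ring

end ChoiAction

/-! ### Information bounds by positive block matrices -/

section Dominated

variable {D : ℕ} {m : Type*} [Fintype m]

/-- A state `ρ` with directional derivatives `X l` has RLD information at most `c`: there is a
positive semidefinite block matrix with first row `ρ, X 0, X 1, …` whose remaining diagonal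
blocks have total trace at most `c`.  By taking Schur complements, this amounts to
`∑ l, Tr[(X l)ᴴ ρ⁻¹ X l] ≤ c` together with the support condition, but it needs no inverse. -/
def Dominated (ρ : Matrix m m ℂ) (X : Fin D → Matrix m m ℂ) (c : ℝ) : Prop :=
  ∃ P : Matrix (Fin (D + 1) × m) (Fin (D + 1) × m) ℂ, P.PosSemidef ∧
    P.submatrix (fun a => (0, a)) (fun a => (0, a)) = ρ ∧
    (∀ l : Fin D, P.submatrix (fun a => (0, a)) (fun a => (l.succ, a)) = X l) ∧
    ∑ l : Fin D, (P.submatrix (fun a => (l.succ, a)) (fun a => (l.succ, a))).trace.re ≤ c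

theorem Dominated.exists_factorization {ρ : Matrix m m ℂ} {X : Fin D → Matrix m m ℂ} {c : ℝ}
    (h : Dominated ρ X c) :
    ∃ (U : Matrix m (Fin (D + 1) × m) ℂ) (V : Fin D → Matrix m (Fin (D + 1) × m) ℂ),
      ρ = U * Uᴴ ∧ (∀ l, X l = U * (V l)ᴴ) ∧ ∑ l, (V l * (V l)ᴴ).trace.re ≤ c := by
  classical
  obtain ⟨P, hP, h0, hX, hc⟩ := h
  obtain ⟨F, rfl⟩ := exists_eq_mul_conjTranspose hP
  have hF : ∀ i j : Fin (D + 1), (F * Fᴴ).submatrix (fun a : m => (i, a)) (fun a => (j, a))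
      = F.submatrix (fun a => (i, a)) id * (F.submatrix (fun a => (j, a)) id)ᴴ := by
    intro i j
    ext a b
    simp [mul_apply]
  refine ⟨F.submatrix (fun a => (0, a)) id, fun l => F.submatrix (fun a => (l.succ, a)) id,
    ?_, fun l => ?_, ?_⟩
  · rw [← h0, hF]
  · rw [← hX, hF]
  · simpa only [hF] using hc

theorem dominated_of_factorization {ι : Type*} [Fintype ι] {ρ : Matrix m m ℂ}
    {X : Fin D → Matrix m m ℂ} {c : ℝ} (U : Matrix m ι ℂ) (V : Fin D → Matrix m ι ℂ)
    (h0 : ρ = U * Uᴴ) (hX : ∀ l, X l = U * (V l)ᴴ) (hc : ∑ l, (V l * (V l)ᴴ).trace.re ≤ c) :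
    Dominated ρ X c := by
  let F : Matrix (Fin (D + 1) × m) ι ℂ :=
    Matrix.of fun p i => (Fin.cons U V : Fin (D + 1) → Matrix m ι ℂ) p.1 p.2 i
  have hF : ∀ i j : Fin (D + 1), (F * Fᴴ).submatrix (fun a : m => (i, a)) (fun a => (j, a))
      = (Fin.cons U V : Fin (D + 1) → Matrix m ι ℂ) i
        * ((Fin.cons U V : Fin (D + 1) → Matrix m ι ℂ) j)ᴴ := by
    intro i j
    ext a b
    simp [mul_apply, F]
  refine ⟨F * Fᴴ, posSemidef_self_mul_conjTranspose F, ?_, fun l => ?_, ?_⟩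
  · rw [hF, h0]; simp
  · rw [hF, hX]; simp
  · simpa only [hF, Fin.cons_succ] using hc

/-- A state that does not depend on the parameter carries no information. -/
theorem dominated_zero {ρ : Matrix m m ℂ} (hρ : ρ.PosSemidef) :
    Dominated (D := D) ρ (fun _ => 0) 0 := by
  classical
  obtain ⟨F, rfl⟩ := exists_eq_mul_conjTranspose hρ
  exact dominated_of_factorization F (fun _ => 0) (by simp) (by simp) (by simp)

/-- Data processing: a channel that does not depend on the parameter does not increase the
information. -/
theorem Dominated.map {m' : Type*} [Fintype m'] {ρ : Matrix m m ℂ} {X : Fin D → Matrix m m ℂ}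
    {c : ℝ} (h : Dominated ρ X c) (S : QuantumChannel m m') :
    Dominated (S.map ρ) (fun l => S.map (X l)) c := by
  obtain ⟨P, hP, h0, hX, hc⟩ := h
  have hS : ∀ i j : Fin (D + 1),
      (ampliate S.map P).submatrix (fun a : m' => (i, a)) (fun a => (j, a))
        = S.map (P.submatrix (fun a => (i, a)) (fun a => (j, a))) := fun i j => rfl
  refine ⟨ampliate S.map P, S.completelyPositive _ P hP, ?_, fun l => ?_, ?_⟩
  · rw [hS, h0]
  · rw [hS, hX]
  · simpa only [hS, S.tracePreserving] using hc

/-- The chain rule: using a parameter-dependent channel once adds at most the information cost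
`∑ l, Tr[(id ⊗ Q l)(ρ)]`, where `Q l` has Choi matrix `G l * (G l)ᴴ`.  The cross terms are traces
of outputs of the derivative of the channel, which vanish since the channel preserves traces. -/
theorem Dominated.choiAct {R A B κ : Type*} [Fintype R] [Fintype A] [Fintype B] [Fintype κ]
    [DecidableEq A]
    {ρ : Matrix (R × A) (R × A) ℂ} {X : Fin D → Matrix (R × A) (R × A) ℂ} {c : ℝ}
    (h : Dominated ρ X c) {H : Matrix (A × B) κ ℂ} {G : Fin D → Matrix (A × B) κ ℂ}
    (hH : ∀ a a', ∑ b, (H * Hᴴ) (a, b) (a', b) = if a = a' then 1 else 0)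
    (hG : ∀ l a a', ∑ b, (H * (G l)ᴴ) (a, b) (a', b) = 0) {v : ℝ}
    (hv : ∑ l, (QuantumEstimation.choiAct (G l * (G l)ᴴ) ρ).trace.re ≤ v) :
    Dominated (QuantumEstimation.choiAct (H * Hᴴ) ρ)
      (fun l => QuantumEstimation.choiAct (H * Hᴴ) (X l)
        + QuantumEstimation.choiAct (H * (G l)ᴴ) ρ) (c + v) := by
  obtain ⟨U, V, h0, hX, hc⟩ := h.exists_factorization
  refine dominated_of_factorization (krausAct H U)
    (fun l => krausAct H (V l) + krausAct (G l) U) ?_ (fun l => ?_) ?_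
  · rw [h0, choiAct_mul_conjTranspose]
  · rw [hX, h0, choiAct_mul_conjTranspose, choiAct_mul_conjTranspose, conjTranspose_add,
      Matrix.mul_add]
  · have hcross : ∀ l, (krausAct H (V l) * (krausAct (G l) U)ᴴ).trace = 0 := by
      intro l
      rw [← choiAct_mul_conjTranspose, trace_choiAct]
      simp [hG]
    have hcross' : ∀ l, (krausAct (G l) U * (krausAct H (V l))ᴴ).trace = 0 := by
      intro l
      have := congrArg star (hcross l)
      rwa [← trace_conjTranspose, conjTranspose_mul, conjTranspose_conjTranspose, star_zero]
        at this
    have htr : ∀ l, (krausAct H (V l) * (krausAct H (V l))ᴴ).trace = (V l * (V l)ᴴ).trace := by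
      intro l
      rw [← choiAct_mul_conjTranspose, trace_choiAct, ← trace_marginal (V l * (V l)ᴴ)]
      simp [hH, trace]
    refine le_trans (le_of_eq ?_) (add_le_add hc hv)
    rw [← Finset.sum_add_distrib]
    refine Finset.sum_congr rfl fun l _ => ?_
    rw [h0, choiAct_mul_conjTranspose, conjTranspose_add, Matrix.mul_add, Matrix.add_mul,
      Matrix.add_mul, trace_add, trace_add, trace_add, hcross, hcross', htr]
    simp

end Dominated

/-! ### Differentiable families -/

section PartialDerivatives

variable {D : ℕ} {m : Type*} {θ : Fin D → ℝ} {j : Fin D}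

/-- The matrix family `M` has the partial derivative `M'` in the direction `j` at `θ`
(entrywise). -/
def HasPartialDeriv (M : (Fin D → ℝ) → Matrix m m ℂ) (θ : Fin D → ℝ) (j : Fin D)
    (M' : Matrix m m ℂ) : Prop :=
  ∀ a b, HasLineDerivAt ℝ (fun ϑ => M ϑ a b) (M' a b) θ (Pi.single j 1)

theorem HasPartialDeriv.partialDeriv_eq {M : (Fin D → ℝ) → Matrix m m ℂ} {M' : Matrix m m ℂ}
    (h : HasPartialDeriv M θ j M') : partialDeriv M θ j = M' := by
  ext a b
  exact (h a b).lineDeriv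

theorem hasPartialDeriv_const (M : Matrix m m ℂ) : HasPartialDeriv (fun _ => M) θ j 0 :=
  fun a b => hasDerivAt_const (0 : ℝ) (M a b)

theorem HasPartialDeriv.isHermitian {M : (Fin D → ℝ) → Matrix m m ℂ} {M' : Matrix m m ℂ}
    (h : HasPartialDeriv M θ j M') (hM : ∀ ϑ, (M ϑ).IsHermitian) : M'.IsHermitian := by
  ext a b
  have h1 : HasLineDerivAt ℝ (fun ϑ => star (M ϑ b a)) (star (M' b a)) θ (Pi.single j 1) :=
    HasDerivAt.star (h b a)
  have h2 : (fun ϑ => star (M ϑ b a)) = fun ϑ => M ϑ a b := funext fun ϑ => (hM ϑ).apply a b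
  rw [h2] at h1
  exact h1.unique (h a b)

theorem HasPartialDeriv.map {m' : Type*} [Fintype m] [DecidableEq m]
    {M : (Fin D → ℝ) → Matrix m m ℂ} {M' : Matrix m m ℂ}
    (h : HasPartialDeriv M θ j M') (L : Matrix m m ℂ →ₗ[ℂ] Matrix m' m' ℂ) :
    HasPartialDeriv (fun ϑ => L (M ϑ)) θ j (L M') := by
  intro b b'
  have hL : ∀ X : Matrix m m ℂ, L X b b' = ∑ a, ∑ a', X a a' * L (single a a' 1) b b' := by
    intro X
    conv_lhs => rw [matrix_eq_sum_single X]
    simp only [map_sum, Matrix.sum_apply]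
    refine Finset.sum_congr rfl fun a _ => Finset.sum_congr rfl fun a' _ => ?_
    have h : single a a' (X a a') = X a a' • single a a' (1 : ℂ) := by
      rw [smul_single, smul_eq_mul, mul_one]
    rw [h, map_smul, Matrix.smul_apply, smul_eq_mul]
  rw [hL M', funext fun ϑ => hL (M ϑ)]
  exact HasDerivAt.fun_sum fun a _ => HasDerivAt.fun_sum fun a' _ =>
    HasDerivAt.mul_const (h a a') _

/-- The product rule for a parameter-dependent map acting on a parameter-dependent operator. -/
theorem HasPartialDeriv.choiAct {R A B : Type*} [Fintype A]
    {J : (Fin D → ℝ) → Matrix (A × B) (A × B) ℂ} {J' : Matrix (A × B) (A × B) ℂ}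
    {X : (Fin D → ℝ) → Matrix (R × A) (R × A) ℂ} {X' : Matrix (R × A) (R × A) ℂ}
    (hJ : HasPartialDeriv J θ j J') (hX : HasPartialDeriv X θ j X') :
    HasPartialDeriv (fun ϑ => QuantumEstimation.choiAct (J ϑ) (X ϑ)) θ j
      (QuantumEstimation.choiAct (J θ) X' + QuantumEstimation.choiAct J' (X θ)) := by
  intro p q
  simp only [QuantumEstimation.choiAct, of_apply, Matrix.add_apply, ← Finset.sum_add_distrib]
  refine HasDerivAt.fun_sum fun a _ => HasDerivAt.fun_sum fun a' _ => ?_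
  have h := HasDerivAt.fun_mul (hX (p.1, a) (q.1, a')) (hJ (a, p.2) (a', q.2))
  simpa only [zero_smul, add_zero] using h

end PartialDerivatives

section ChoiMatrix

variable {D : ℕ} {A B : Type*} [Fintype A] [DecidableEq A] [Fintype B]

theorem sum_choi_apply (N : QuantumChannel A B) (a a' : A) :
    ∑ b, N.choi (a, b) (a', b) = if a = a' then 1 else 0 := by
  have h : ∑ b, N.choi (a, b) (a', b)
      = (N.map (Matrix.of fun x y => if a = x ∧ a' = y then (1 : ℂ) else 0)).trace := rfl
  rw [h, N.tracePreserving]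
  simp [trace, ite_and, eq_comm (a := a')]

theorem hasPartialDeriv_choi {Θ : Set (Fin D → ℝ)} {N : (Fin D → ℝ) → QuantumChannel A B}
    (hN : IsDifferentiableFamily Θ N) {θ : Fin D → ℝ} (hθ : θ ∈ Θ) (j : Fin D) :
    HasPartialDeriv (fun ϑ => (N ϑ).choi) θ j (partialDeriv (fun ϑ => (N ϑ).choi) θ j) :=
  fun p q => (hN θ hθ j _ p.2 q.2).hasLineDerivAt

theorem sum_partialDeriv_choi_apply {Θ : Set (Fin D → ℝ)}
    {N : (Fin D → ℝ) → QuantumChannel A B} (hN : IsDifferentiableFamily Θ N)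
    {θ : Fin D → ℝ} (hθ : θ ∈ Θ) (j : Fin D) (a a' : A) :
    ∑ b, partialDeriv (fun ϑ => (N ϑ).choi) θ j (a, b) (a', b) = 0 := by
  have h1 : HasLineDerivAt ℝ (fun ϑ => ∑ b, (N ϑ).choi (a, b) (a', b))
      (∑ b, partialDeriv (fun ϑ => (N ϑ).choi) θ j (a, b) (a', b)) θ (Pi.single j 1) :=
    HasDerivAt.fun_sum fun b _ => hasPartialDeriv_choi hN hθ j (a, b) (a', b)
  simp only [sum_choi_apply] at h1
  exact h1.unique (hasDerivAt_const (0 : ℝ) _)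

/-- Complete positivity is stated for reference systems `Fin k`, so the reference copy of `A` is
relabelled. -/
theorem choi_posSemidef (N : QuantumChannel A B) : N.choi.PosSemidef := by
  have h : (Matrix.of fun p q : A × A => if p.1 = p.2 ∧ q.1 = q.2 then (1 : ℂ) else 0)
      = pureMatrix (1 : Matrix A A ℂ) := by
    ext p q
    by_cases h1 : p.1 = p.2 <;> by_cases h2 : q.1 = q.2 <;>
      simp [pureMatrix, vecMulVec_apply, one_apply, h1, h2]
  obtain ⟨e⟩ := Fintype.truncEquivFin A |>.nonempty
  have h2 := N.completelyPositive _ _ ((pureMatrix_posSemidef (1 : Matrix A A ℂ)).submatrix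
    (fun p : Fin (Fintype.card A) × A => (e.symm p.1, p.2)))
  have h3 := h2.submatrix (fun p : A × B => (e p.1, p.2))
  rw [← h] at h3
  convert h3 using 1
  ext p q
  refine congrArg (fun X => N.map X p.2 q.2) ?_
  ext a a'
  simp

end ChoiMatrix

/-! ### The channel value bounds the cost of each use -/

section ChannelValue

variable {D : ℕ} {A B : Type*} [Fintype A] [DecidableEq A] [Fintype B] [DecidableEq B]

/-- For a pure input state with invertible amplitude matrix, the output support condition turns
the information value into an expectation of the operators `(M l)ᴴ Γ⁻¹ M l`, where `Γ` is the Choi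
matrix and `M l` its directional derivatives. -/
theorem sum_trace_choiAct_pureMatrix_le {Θ : Set (Fin D → ℝ)}
    {N : (Fin D → ℝ) → QuantumChannel A B} (hN : IsDifferentiableFamily Θ N)
    {θ : Fin D → ℝ} (hθ : θ ∈ Θ) (C : Matrix (Fin D) (Fin D) ℂ)
    (hfin : RLDFinite (C * Cᴴ) (fun ϑ => (N ϑ).choi) θ)
    (htop : rldValueChannel (C * Cᴴ) N θ ≠ ⊤) {r : ℕ} {K : Matrix (Fin r) A ℂ}
    {J : Matrix A (Fin r) ℂ} (hJK : J * K = 1) (htr : (pureMatrix K).trace = 1) :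
    ∑ l, (choiAct ((combine C (partialDeriv (fun ϑ => (N ϑ).choi) θ) l)ᴴ
      * supportInv (N θ).choi * combine C (partialDeriv (fun ϑ => (N ϑ).choi) θ) l)
        (pureMatrix K)).trace.re ≤ (rldValueChannel (C * Cᴴ) N θ).toReal := by
  let ψ : DensityMatrix (Fin r × A) := ⟨pureMatrix K, pureMatrix_posSemidef K, htr⟩
  let σ : (Fin D → ℝ) → Matrix (Fin r × B) (Fin r × B) ℂ := fun ϑ => ((N ϑ).applySnd ψ).mat
  have hle : rldValueState (C * Cᴴ) σ θ ≤ rldValueChannel (C * Cᴴ) N θ := by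
    rw [rldValueChannel, if_pos hfin]
    exact le_iSup₂ (f := fun (r : ℕ) (ρ : DensityMatrix (Fin r × A)) =>
      rldValueState (C * Cᴴ) (fun ϑ => ((N ϑ).applySnd ρ).mat) θ) r ψ
  -- Otherwise this input state alone would make the channel value infinite.
  have hσfin : RLDFinite (C * Cᴴ) σ θ := by
    by_contra hcon
    rw [rldValueState, if_neg hcon] at hle
    exact htop (top_le_iff.mp hle)
  rw [rldValueState, if_pos hσfin, ENNReal.ofReal_le_iff_le_toReal htop] at hle
  set M := partialDeriv (fun ϑ => (N ϑ).choi) θ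
  have hσ : ∀ ϑ, σ ϑ = choiAct (N ϑ).choi (pureMatrix K) := fun ϑ =>
    ampliate_eq_choiAct (N ϑ) _
  have hder : ∀ k, HasPartialDeriv σ θ k (choiAct (M k) (pureMatrix K)) := by
    intro k
    have h := (hasPartialDeriv_choi hN hθ k).choiAct
      (hasPartialDeriv_const (θ := θ) (j := k) (pureMatrix K))
    rw [choiAct_zero, zero_add] at h
    rwa [show σ = fun ϑ => choiAct (N ϑ).choi (pureMatrix K) from funext hσ]
  have hherm : ∀ k, (partialDeriv σ θ k).IsHermitian := by
    intro k
    rw [(hder k).partialDeriv_eq]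
    exact (hder k).isHermitian fun ϑ => ((N ϑ).applySnd ψ).posSemidef.isHermitian
  have hcomb : ∀ l, combine C (partialDeriv σ θ) l
      = (K ⊗ₖ (1 : Matrix B B ℂ)) * combine C M l * (K ⊗ₖ (1 : Matrix B B ℂ))ᴴ := by
    intro l
    have h : partialDeriv σ θ = fun k => choiAct 0 (0 : Matrix (Fin r × A) (Fin r × A) ℂ)
        + choiAct (M k) (pureMatrix K) := by
      funext k
      rw [(hder k).partialDeriv_eq, choiAct_zero, zero_add]
    rw [h, choiAct_combine_add C 0 M (pureMatrix K) (fun _ => 0) l, choiAct_pureMatrix]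
    simp [choiAct, combine]
    rfl
  have hsupp := mul_supportInv_mul_combine_of_rldFinite C
    ((N θ).applySnd ψ).posSemidef.isHermitian hherm hσfin
  rw [trace_mul_rldMatrix C hherm, Complex.re_sum] at hle
  refine le_trans (le_of_eq (Finset.sum_congr rfl fun l _ => ?_)) hle
  have hinv : (J ⊗ₖ (1 : Matrix B B ℂ)) * (K ⊗ₖ (1 : Matrix B B ℂ)) = 1 := by
    rw [← mul_kronecker_mul, hJK, Matrix.one_mul, one_kronecker_one]
  have hs := hsupp l
  simp only [hcomb, hσ, choiAct_pureMatrix] at hs ⊢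
  rw [congruence_supportInv hinv (choi_posSemidef (N θ)).isHermitian hs]

/-- The value of the channel family bounds the expectation of the operators `(M l)ᴴ Γ⁻¹ M l` in
every input state.  Positive definite marginals on `A` are purified by invertible amplitude
matrices; the others are limits of mixtures with the maximally mixed state. -/
theorem sum_trace_choiAct_le {Θ : Set (Fin D → ℝ)}
    {N : (Fin D → ℝ) → QuantumChannel A B} (hN : IsDifferentiableFamily Θ N)
    {θ : Fin D → ℝ} (hθ : θ ∈ Θ) (C : Matrix (Fin D) (Fin D) ℂ)
    (hfin : RLDFinite (C * Cᴴ) (fun ϑ => (N ϑ).choi) θ)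
    (htop : rldValueChannel (C * Cᴴ) N θ ≠ ⊤) {r : ℕ} (ρ : DensityMatrix (Fin r × A)) :
    ∑ l, (choiAct ((combine C (partialDeriv (fun ϑ => (N ϑ).choi) θ) l)ᴴ
      * supportInv (N θ).choi * combine C (partialDeriv (fun ϑ => (N ϑ).choi) θ) l)
        ρ.mat).trace.re ≤ (rldValueChannel (C * Cᴴ) N θ).toReal := by
  have hpure := @sum_trace_choiAct_pureMatrix_le D A B _ _ _ _ Θ N hN θ hθ C hfin htop
  simp only [trace_choiAct] at hpure ⊢
  set Q : Fin D → Matrix (A × B) (A × B) ℂ := fun l =>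
    (combine C (partialDeriv (fun ϑ => (N ϑ).choi) θ) l)ᴴ
      * supportInv (N θ).choi * combine C (partialDeriv (fun ϑ => (N ϑ).choi) θ) l
  set v := (rldValueChannel (C * Cᴴ) N θ).toReal
  -- The left-hand side depends on `ρ` only through its marginal on `A`, and linearly so.
  let φ : Matrix A A ℂ → ℝ := fun τ =>
    ∑ l, (∑ a, ∑ a', τ a a' * ∑ b, Q l (a, b) (a', b)).re
  have hφ : ∀ (s t : ℝ) (τ τ' : Matrix A A ℂ), φ (s • τ + t • τ') = s * φ τ + t * φ τ' := by
    intro s t τ τ'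
    simp only [φ, Finset.mul_sum, ← Finset.sum_add_distrib]
    refine Finset.sum_congr rfl fun l _ => ?_
    rw [← Complex.re_ofReal_mul, ← Complex.re_ofReal_mul, ← Complex.add_re, Finset.mul_sum,
      Finset.mul_sum, ← Finset.sum_add_distrib]
    congr 1
    refine Finset.sum_congr rfl fun a _ => ?_
    rw [Finset.mul_sum, Finset.mul_sum, ← Finset.sum_add_distrib]
    refine Finset.sum_congr rfl fun a' _ => ?_
    simp only [Matrix.add_apply, Matrix.smul_apply, Complex.real_smul, Finset.mul_sum,
      ← Finset.sum_add_distrib]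
    exact Finset.sum_congr rfl fun b _ => by ring
  have hpos : ∀ τ : Matrix A A ℂ, τ.PosDef → τ.trace = 1 → φ τ ≤ v := by
    intro τ hτ hτ1
    obtain ⟨F, hF⟩ := exists_eq_mul_conjTranspose hτ.posSemidef
    have hdet : IsUnit Fᵀ.det := by
      have h := (isUnit_iff_isUnit_det _).mp hτ.isUnit
      rw [hF, det_mul] at h
      rw [det_transpose]
      exact isUnit_of_mul_isUnit_left h
    obtain ⟨e⟩ := Fintype.truncEquivFin A |>.nonempty
    have hmarg : marginal (pureMatrix (Fᵀ.submatrix e.symm id)) = τ := by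
      rw [marginal_pureMatrix, hF]
      ext a a'
      simp only [mul_apply, transpose_apply, submatrix_apply, conjTranspose_apply, id]
      exact e.symm.sum_comp fun x => F a x * star (F a' x)
    have h := hpure (K := Fᵀ.submatrix e.symm id) (J := (Fᵀ)⁻¹.submatrix id e.symm)
      (by rw [submatrix_mul_equiv, nonsing_inv_mul _ hdet, submatrix_id_id])
      (by rw [← trace_marginal, hmarg, hτ1])
    rwa [hmarg] at h
  have hA : Nonempty A := by
    by_contra hA
    rw [not_nonempty_iff] at hA
    have h := ρ.trace_eq_one
    simp [trace] at h
  have hcard : (0 : ℝ) < Fintype.card A := Nat.cast_pos.mpr Fintype.card_pos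
  set τ := marginal ρ.mat
  let μ : Matrix A A ℂ := ((Fintype.card A : ℝ)⁻¹) • (1 : Matrix A A ℂ)
  have hmix : ∀ ε ∈ Set.Ioo (0 : ℝ) 1, (1 - ε) * φ τ + ε * φ μ ≤ v := by
    intro ε hε
    rw [← hφ]
    refine hpos _ ?_ ?_
    · refine PosDef.posSemidef_add ?_ ?_
      · exact (marginal_posSemidef ρ.posSemidef).smul (sub_nonneg.mpr hε.2.le)
      · exact (PosDef.one.smul (inv_pos.mpr hcard)).smul hε.1
    · rw [trace_add, trace_smul, trace_smul, trace_smul, trace_one, trace_marginal,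
        ρ.trace_eq_one]
      simp
  have hlim : Filter.Tendsto (fun ε : ℝ => (1 - ε) * φ τ + ε * φ μ)
      (nhdsWithin 0 (Set.Ioi 0)) (nhds (φ τ)) := by
    have h : Continuous fun ε : ℝ => (1 - ε) * φ τ + ε * φ μ := by fun_prop
    have h0 := h.tendsto 0
    simp only [sub_zero, one_mul, zero_mul, add_zero] at h0
    exact h0.mono_left nhdsWithin_le_nhds
  refine le_of_tendsto hlim ?_
  filter_upwards [Ioo_mem_nhdsGT (zero_lt_one (α := ℝ))] with ε hε using hmix ε hε

end ChannelValue

/-! ### Sequential schemes -/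

section Sequential

variable {D : ℕ} {A B : Type*} [Fintype A] [DecidableEq A] [Fintype B] [DecidableEq B]

/-- The information carried by the final state of a sequential scheme with `n` channel uses is at
most `n` times the value of the channel family. -/
theorem SequentialScheme.finalState_dominated {Θ : Set (Fin D → ℝ)}
    {N : (Fin D → ℝ) → QuantumChannel A B} (hN : IsDifferentiableFamily Θ N)
    {θ : Fin D → ℝ} (hθ : θ ∈ Θ) (C : Matrix (Fin D) (Fin D) ℂ)
    (hfin : RLDFinite (C * Cᴴ) (fun ϑ => (N ϑ).choi) θ)
    (htop : rldValueChannel (C * Cᴴ) N θ ≠ ⊤) {n r : ℕ} (S : SequentialScheme A B n r) :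
    ∃ X : Fin D → Matrix (Fin r × B) (Fin r × B) ℂ,
      (∀ j, HasPartialDeriv (fun ϑ => (S.finalState (N ϑ)).mat) θ j (X j)) ∧
      Dominated (S.finalState (N θ)).mat (combine C X)
        (n * (rldValueChannel (C * Cᴴ) N θ).toReal) := by
  set M := partialDeriv (fun ϑ => (N ϑ).choi) θ
  set v := (rldValueChannel (C * Cᴴ) N θ).toReal
  have hΓ := choi_posSemidef (N θ)
  have hMherm : ∀ k, (M k).IsHermitian := fun k =>
    (hasPartialDeriv_choi hN hθ k).isHermitian fun ϑ => (choi_posSemidef (N ϑ)).isHermitian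
  have hsupp := mul_supportInv_mul_combine_of_rldFinite C hΓ.isHermitian hMherm hfin
  obtain ⟨H, hH⟩ := exists_eq_mul_conjTranspose hΓ
  have hR : (supportInv (N θ).choi)ᴴ = supportInv (N θ).choi := supportInv_isHermitian _
  -- `G l` is chosen so that `H * (G l)ᴴ` is the derivative `M l` of the Choi matrix `Γ = H * Hᴴ`
  -- and `G l * (G l)ᴴ = (M l)ᴴ Γ⁻¹ M l` is the operator bounded by the channel value.
  let G : Fin D → Matrix (A × B) (A × B) ℂ := fun l =>
    (combine C M l)ᴴ * supportInv (N θ).choi * H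
  have hHG : ∀ l, H * (G l)ᴴ = combine C M l := by
    intro l
    have h : (G l)ᴴ = Hᴴ * (supportInv (N θ).choi * combine C M l) := by
      simp only [G, conjTranspose_mul, conjTranspose_conjTranspose, hR]
    rw [h, ← Matrix.mul_assoc, ← hH, ← Matrix.mul_assoc]
    exact hsupp l
  have hGG : ∀ l, G l * (G l)ᴴ
      = (combine C M l)ᴴ * supportInv (N θ).choi * combine C M l := by
    intro l
    have h : G l * (G l)ᴴ = (combine C M l)ᴴ * supportInv (N θ).choi * (H * (G l)ᴴ) :=
      Matrix.mul_assoc _ _ _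
    rw [h, hHG]
  -- One use of the unknown channel on a parameter-dependent input costs at most `v`.
  have hstep : ∀ {r : ℕ} (ρ : (Fin D → ℝ) → DensityMatrix (Fin r × A))
      (X : Fin D → Matrix (Fin r × A) (Fin r × A) ℂ) (c : ℝ),
      (∀ j, HasPartialDeriv (fun ϑ => (ρ ϑ).mat) θ j (X j)) →
      Dominated (ρ θ).mat (combine C X) c →
      ∃ Y : Fin D → Matrix (Fin r × B) (Fin r × B) ℂ,
        (∀ j, HasPartialDeriv (fun ϑ => ((N ϑ).applySnd (ρ ϑ)).mat) θ j (Y j)) ∧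
        Dominated ((N θ).applySnd (ρ θ)).mat (combine C Y) (c + v) := by
    intro r ρ X c hX hdom
    have happ : ∀ ϑ, ((N ϑ).applySnd (ρ ϑ)).mat = choiAct (N ϑ).choi (ρ ϑ).mat := fun ϑ =>
      ampliate_eq_choiAct (N ϑ) _
    refine ⟨fun k => choiAct (N θ).choi (X k) + choiAct (M k) (ρ θ).mat, fun j => ?_, ?_⟩
    · simp only [happ]
      exact (hasPartialDeriv_choi hN hθ j).choiAct (hX j)
    · have hY : combine C (fun k => choiAct (N θ).choi (X k) + choiAct (M k) (ρ θ).mat)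
          = fun l => choiAct (H * Hᴴ) (combine C X l) + choiAct (H * (G l)ᴴ) (ρ θ).mat := by
        funext l
        rw [choiAct_combine_add, hHG, ← hH]
      rw [happ, hY, hH]
      refine hdom.choiAct ?_ ?_ ?_
      · rw [← hH]
        exact sum_choi_apply (N θ)
      · intro l a a'
        rw [hHG]
        simp only [combine, Matrix.sum_apply, Matrix.smul_apply]
        rw [Finset.sum_comm]
        refine Finset.sum_eq_zero fun k _ => ?_
        rw [← Finset.smul_sum, sum_partialDeriv_choi_apply hN hθ, smul_zero]
      · simp only [hGG]
        exact sum_trace_choiAct_le hN hθ C hfin htop (ρ θ)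
  induction S with
  | @first r ρ =>
    obtain ⟨Y, hY, hdom⟩ := hstep (fun _ => ρ) (fun _ => 0) 0
      (fun j => hasPartialDeriv_const ρ.mat)
      (by
        have h : combine C (fun _ => 0) = fun _ => (0 : Matrix (Fin r × A) (Fin r × A) ℂ) := by
          funext l
          simp only [combine, smul_zero, Finset.sum_const_zero]
        rw [h]
        exact dominated_zero ρ.posSemidef)
    refine ⟨Y, hY, ?_⟩
    rw [Nat.cast_one, one_mul, ← zero_add v]
    exact hdom
  | @next n r r' P S ih =>
    obtain ⟨X, hX, hdom⟩ := ih
    have hcomb : (fun l => S.map (combine C X l)) = combine C fun k => S.map (X k) := by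
      funext l
      simp only [combine, map_sum, map_smul]
    obtain ⟨Y, hY, hdom'⟩ := hstep (fun ϑ => S.apply (P.finalState (N ϑ)))
      (fun k => S.map (X k)) _ (fun j => (hX j).map S.map) (hcomb ▸ hdom.map S)
    refine ⟨Y, hY, ?_⟩
    have h : ((n + 1 : ℕ) : ℝ) * v = n * v + v := by push_cast; ring
    rw [h]
    exact hdom'

end Sequential

/-! ### Cauchy–Schwarz for finitely many outcomes -/

section CauchySchwarz

theorem norm_sq_sum_trace_mul_conjTranspose_le {κ m ι : Type*} [Fintype κ] [Fintype m]
    [Fintype ι] (S T : κ → Matrix m ι ℂ) :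
    ‖∑ l, (S l * (T l)ᴴ).trace‖ ^ 2
      ≤ (∑ l, (S l * (S l)ᴴ).trace.re) * ∑ l, (T l * (T l)ᴴ).trace.re := by
  have h1 : ∀ S T : κ → Matrix m ι ℂ, ∑ l, (S l * (T l)ᴴ).trace
      = ∑ x : κ × m × ι, S x.1 x.2.1 x.2.2 * star (T x.1 x.2.1 x.2.2) := by
    intro S T
    simp only [trace, diag_apply, mul_apply, conjTranspose_apply, Fintype.sum_prod_type]
  have h2 : ∀ S : κ → Matrix m ι ℂ, ∑ l, (S l * (S l)ᴴ).trace.re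
      = ∑ x : κ × m × ι, ‖S x.1 x.2.1 x.2.2‖ ^ 2 := by
    intro S
    rw [← Complex.re_sum, h1, Complex.re_sum]
    refine Finset.sum_congr rfl fun x _ => ?_
    rw [Complex.star_def, Complex.mul_conj, Complex.ofReal_re, Complex.normSq_eq_norm_sq]
  rw [h1, h2, h2]
  refine le_trans ?_ (Finset.sum_mul_sq_le_sq_mul_sq _ _ _)
  refine pow_le_pow_left₀ (norm_nonneg _) ((norm_sum_le _ _).trans (le_of_eq ?_)) 2
  simp only [norm_mul, norm_star]

variable {m ι : Type*} [Fintype m] [DecidableEq m]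

/-- Kadison's inequality `Tᴴ T ≤ ∑ y, |f y|² E y` for `T = ∑ y, f y • E y`, where `E` is a finite
resolution of the identity by positive operators, evaluated in the state `ρ`. -/
theorem trace_mul_conjTranspose_mul_le (s : Finset ι) {E : ι → Matrix m m ℂ}
    (hE : ∀ y ∈ s, (E y).PosSemidef) (hsum : ∑ y ∈ s, E y = 1) (f : ι → ℂ)
    {ρ : Matrix m m ℂ} (hρ : ρ.PosSemidef) :
    ((∑ y ∈ s, f y • E y)ᴴ * (∑ y ∈ s, f y • E y) * ρ).trace.re
      ≤ ∑ y ∈ s, ‖f y‖ ^ 2 * (E y * ρ).trace.re := by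
  set T := ∑ y ∈ s, f y • E y with hT
  have hTs : Tᴴ = ∑ y ∈ s, star (f y) • E y := by
    rw [hT, conjTranspose_sum]
    exact Finset.sum_congr rfl fun y hy => by rw [conjTranspose_smul, (hE y hy).isHermitian.eq]
  -- The defect in Kadison's inequality is a sum of positive operators.
  have hexp : ∑ y ∈ s, (f y • (1 : Matrix m m ℂ) - T)ᴴ * E y * (f y • (1 : Matrix m m ℂ) - T)
      = (∑ y ∈ s, ((‖f y‖ ^ 2 : ℝ) : ℂ) • E y) - Tᴴ * T := by
    have h : ∀ y ∈ s, (f y • (1 : Matrix m m ℂ) - T)ᴴ * E y * (f y • (1 : Matrix m m ℂ) - T)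
        = ((‖f y‖ ^ 2 : ℝ) : ℂ) • E y - (star (f y) • E y) * T - Tᴴ * (f y • E y)
          + Tᴴ * E y * T := by
      intro y _
      rw [← Complex.normSq_eq_norm_sq, ← Complex.mul_conj, ← Complex.star_def]
      simp only [conjTranspose_sub, conjTranspose_smul, conjTranspose_one, Matrix.sub_mul,
        Matrix.mul_sub, smul_mul_assoc, mul_smul_comm, Matrix.one_mul, Matrix.mul_one, smul_smul,
        smul_sub]
      abel
    rw [Finset.sum_congr rfl h, Finset.sum_add_distrib, Finset.sum_sub_distrib,
      Finset.sum_sub_distrib, ← Finset.sum_mul, ← hTs, ← Finset.mul_sum, ← hT, ← Finset.sum_mul,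
      ← Finset.mul_sum, hsum, Matrix.mul_one]
    abel
  have hpos : (∑ y ∈ s, (f y • (1 : Matrix m m ℂ) - T)ᴴ * E y
      * (f y • (1 : Matrix m m ℂ) - T)).PosSemidef :=
    posSemidef_sum _ fun y hy => (hE y hy).conjTranspose_mul_mul_same _
  have h := trace_mul_nonneg hpos hρ
  rw [hexp, Matrix.sub_mul, trace_sub, Complex.sub_re, sub_nonneg] at h
  refine h.trans (le_of_eq ?_)
  rw [Finset.sum_mul, trace_sum, Complex.re_sum]
  refine Finset.sum_congr rfl fun y _ => ?_
  rw [smul_mul_assoc, trace_smul, smul_eq_mul, Complex.re_ofReal_mul]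

/-- The Cauchy–Schwarz inequality behind the Cramér–Rao bound, for a measurement with finitely
many outcomes. -/
theorem Dominated.norm_sq_sum_le {D : ℕ} (s : Finset ι) {E : ι → Matrix m m ℂ}
    (hE : ∀ y ∈ s, (E y).PosSemidef) (hsum : ∑ y ∈ s, E y = 1) (f : Fin D → ι → ℂ)
    {ρ : Matrix m m ℂ} {X : Fin D → Matrix m m ℂ} {c : ℝ} (h : Dominated ρ X c) :
    ‖∑ l, ∑ y ∈ s, f l y * (E y * X l).trace‖ ^ 2
      ≤ (∑ l, ∑ y ∈ s, ‖f l y‖ ^ 2 * (E y * ρ).trace.re) * c := by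
  obtain ⟨U, V, h0, hX, hc⟩ := h.exists_factorization
  have hρ : ρ.PosSemidef := h0 ▸ posSemidef_self_mul_conjTranspose U
  have h1 : ∀ l, ∑ y ∈ s, f l y * (E y * X l).trace
      = (((∑ y ∈ s, f l y • E y) * U) * (V l)ᴴ).trace := by
    intro l
    rw [Matrix.mul_assoc, ← hX, Finset.sum_mul, trace_sum]
    simp only [smul_mul_assoc, trace_smul, smul_eq_mul]
  have h2 : ∀ l, (((∑ y ∈ s, f l y • E y) * U) * ((∑ y ∈ s, f l y • E y) * U)ᴴ).trace.re
      ≤ ∑ y ∈ s, ‖f l y‖ ^ 2 * (E y * ρ).trace.re := by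
    intro l
    refine le_trans (le_of_eq ?_) (trace_mul_conjTranspose_mul_le s hE hsum (f l) hρ)
    rw [conjTranspose_mul, ← Matrix.mul_assoc, Matrix.mul_assoc _ U, ← h0, trace_mul_comm,
      Matrix.mul_assoc]
  simp only [h1]
  refine (norm_sq_sum_trace_mul_conjTranspose_le _ _).trans ?_
  refine mul_le_mul (Finset.sum_le_sum fun l _ => h2 l) hc ?_ ?_
  · exact Finset.sum_nonneg fun l _ =>
      (Complex.nonneg_iff.mp (posSemidef_self_mul_conjTranspose (V l)).trace_nonneg).1
  · exact Finset.sum_nonneg fun l _ => Finset.sum_nonneg fun y hy =>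
      mul_nonneg (sq_nonneg _) (trace_mul_nonneg (hE y hy) hρ)

end CauchySchwarz

/-! ### Outcome distributions -/

section Measurement

theorem trace_mul_ofReal_re {m : Type*} [Fintype m] {X Y : Matrix m m ℂ}
    (hX : X.IsHermitian) (hY : Y.IsHermitian) :
    (((X * Y).trace.re : ℝ) : ℂ) = (X * Y).trace := by
  rw [← Complex.conj_eq_iff_re, ← Complex.star_def, ← trace_conjTranspose, conjTranspose_mul,
    hX.eq, hY.eq, trace_mul_comm]

variable {m Ω : Type*} [Fintype m] [DecidableEq m] [MeasurableSpace Ω]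

instance (Λ : POVM m Ω) (ρ : DensityMatrix m) : IsProbabilityMeasure (Λ.outcome ρ) where
  measure_univ := by
    rw [Λ.outcome_apply ρ MeasurableSet.univ, Λ.effect_univ, Matrix.one_mul, ρ.trace_eq_one]
    simp

theorem POVM.sum_effect_preimage {E : Type*} (Λ : POVM m Ω) (s : SimpleFunc Ω E) :
    ∑ y ∈ s.range, Λ.effect (s ⁻¹' {y}) = 1 := by
  rw [← Λ.effect.of_biUnion_finset, ← Λ.effect_univ]
  · congr 1
    ext x
    simp
  · intro y _ y' _ hne
    exact Disjoint.preimage _ (by simpa using hne)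
  · exact fun y _ => s.measurableSet_fiber y

theorem POVM.integral_comp_simpleFunc {E : Type*} (Λ : POVM m Ω) (ρ : DensityMatrix m)
    (s : SimpleFunc Ω E) (g : E → ℝ) :
    ∫ x, g (s x) ∂(Λ.outcome ρ)
      = ∑ y ∈ s.range, g y * (Λ.effect (s ⁻¹' {y}) * ρ.mat).trace.re := by
  have h1 : (fun x => g (s x))
      = fun x => ∑ y ∈ s.range, (s ⁻¹' {y}).indicator (fun _ => g y) x := by
    funext x
    rw [Finset.sum_eq_single_of_mem (s x) (s.mem_range_self x)]
    · rw [Set.indicator_of_mem (by simp)]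
    · intro y _ hy
      rw [Set.indicator_of_notMem (by simpa using hy.symm)]
  rw [h1, integral_finsetSum]
  · refine Finset.sum_congr rfl fun y _ => ?_
    rw [integral_indicator_const _ (s.measurableSet_fiber y), Measure.real,
      Λ.outcome_apply ρ (s.measurableSet_fiber y), smul_eq_mul, mul_comm, ENNReal.toReal_ofReal]
    exact trace_mul_nonneg (Λ.posSemidef _ (s.measurableSet_fiber y)) ρ.posSemidef
  · exact fun y _ => (integrable_const _).indicator (s.measurableSet_fiber y)

end Measurement

/-! ### Discretizing the estimate -/

section Approximation

variable {D : ℕ}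

/-- Simple functions approximating the identity of `ℝ^D`, by which an estimate is discretized. -/
noncomputable def discretize (D n : ℕ) : SimpleFunc (Fin D → ℝ) (Fin D → ℝ) :=
  SimpleFunc.approxOn id measurable_id Set.univ 0 (Set.mem_univ 0) n

theorem tendsto_discretize (x : Fin D → ℝ) :
    Filter.Tendsto (fun n => discretize D n x) Filter.atTop (nhds x) :=
  SimpleFunc.tendsto_approxOn measurable_id (Set.mem_univ 0) (by simp)

theorem norm_discretize_le (n : ℕ) (x : Fin D → ℝ) : ‖discretize D n x‖ ≤ 2 * ‖x‖ := by
  rw [two_mul]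
  exact SimpleFunc.norm_approxOn_zero_le measurable_id (Set.mem_univ 0) x n

theorem tendsto_integral_discretize {P : Measure (Fin D → ℝ)} {g : (Fin D → ℝ) → ℝ}
    (hg : Continuous g) {bound : (Fin D → ℝ) → ℝ} (hb : Integrable bound P)
    (hle : ∀ x y, ‖y‖ ≤ 2 * ‖x‖ → ‖g y‖ ≤ bound x) :
    Filter.Tendsto (fun n => ∫ x, g (discretize D n x) ∂P) Filter.atTop (nhds (∫ x, g x ∂P)) := by
  refine tendsto_integral_of_dominated_convergence bound (fun n => ?_) hb (fun n => ?_) ?_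
  · exact (hg.measurable.comp (discretize D n).measurable).aestronglyMeasurable
  · exact Filter.Eventually.of_forall fun x => hle _ _ (norm_discretize_le n x)
  · exact Filter.Eventually.of_forall fun x => (hg.tendsto x).comp (tendsto_discretize x)

theorem tendsto_integral_discretize_sub {P : Measure (Fin D → ℝ)} [IsProbabilityMeasure P]
    (hP : ∀ i, Integrable (fun x => x i) P) (c : ℝ) (j : Fin D) :
    Filter.Tendsto (fun n => ∫ x, (discretize D n x j - c) ∂P) Filter.atTop
      (nhds (∫ x, x j ∂P - c)) := by
  have h1 : Integrable (fun x : Fin D → ℝ => x) P := Integrable.of_eval hP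
  have h2 := tendsto_integral_discretize (P := P) (g := fun x => x j - c) (by fun_prop)
    (bound := fun x => 2 * ‖x‖ + |c|) ((h1.norm.const_mul 2).add (integrable_const _)) (by
      intro x y h
      refine (norm_sub_le _ _).trans (add_le_add ((norm_le_pi_norm y j).trans h) le_rfl))
  rwa [integral_sub (hP j) (integrable_const _), integral_const, probReal_univ, one_smul] at h2

theorem tendsto_integral_discretize_mul {P : Measure (Fin D → ℝ)} [IsProbabilityMeasure P]
    (hP : ∀ i, MemLp (fun x : Fin D → ℝ => x i) 2 P) (θ : Fin D → ℝ) (j k : Fin D) :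
    Filter.Tendsto
      (fun n => ∫ x, (discretize D n x j - θ j) * (discretize D n x k - θ k) ∂P) Filter.atTop
      (nhds (covMatrix P θ j k)) := by
  have h1 : MemLp (fun x : Fin D → ℝ => x) 2 P := MemLp.of_eval hP
  have h2 : MemLp (fun x : Fin D → ℝ => 2 * ‖x‖ + ‖θ‖) 2 P :=
    (h1.norm.const_mul 2).add (memLp_const _)
  refine tendsto_integral_discretize (P := P)
    (g := fun x => (x j - θ j) * (x k - θ k)) (by fun_prop) h2.integrable_sq ?_
  intro x y h
  have h3 : ∀ i, ‖y i - θ i‖ ≤ 2 * ‖x‖ + ‖θ‖ := fun i =>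
    (norm_sub_le _ _).trans (add_le_add ((norm_le_pi_norm y i).trans h) (norm_le_pi_norm θ i))
  rw [norm_mul, sq]
  exact mul_le_mul (h3 j) (h3 k) (norm_nonneg _) (by positivity)

end Approximation

/-! ### The Cramér–Rao inequality -/

section CramerRao

variable {D : ℕ} {m : Type*} [Fintype m]

theorem mem_of_hasDerivAt_of_eventually_mem {E : Type*} [NormedAddCommGroup E]
    [NormedSpace ℝ E] [FiniteDimensional ℝ E] (V : Submodule ℝ E) {f : ℝ → E} {f' : E}
    (h : HasDerivAt f f' 0) (hV : ∀ᶠ t in nhds 0, f t ∈ V) : f' ∈ V := by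
  refine V.closed_of_finiteDimensional.mem_of_tendsto (hasDerivAt_iff_tendsto_slope.mp h) ?_
  filter_upwards [nhdsWithin_le_nhds hV] with t ht
  exact V.smul_mem _ (V.sub_mem ht hV.self_of_nhds)

/-- The pair of the derivatives of `ϑ ↦ ρ ϑ` and of `ϑ ↦ ϑ` is a finite linear combination of
values of the pair.  Hence the derivative of the mean of an unbiased estimate can be computed
without differentiating under an integral sign. -/
theorem HasPartialDeriv.mem_span {Θ : Set (Fin D → ℝ)} (hΘ : IsOpen Θ)
    {ρ : (Fin D → ℝ) → Matrix m m ℂ} {θ : Fin D → ℝ} (hθ : θ ∈ Θ) {k : Fin D}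
    {X : Matrix m m ℂ} (hX : HasPartialDeriv ρ θ k X) :
    ((X, Pi.single k 1) : Matrix m m ℂ × (Fin D → ℝ))
      ∈ Submodule.span ℝ ((fun ϑ => (ρ ϑ, ϑ - θ)) '' Θ) := by
  let V : Submodule ℝ ((m → m → ℂ) × (Fin D → ℝ)) :=
    Submodule.span ℝ ((fun ϑ => (ρ ϑ, ϑ - θ)) '' Θ)
  let f : ℝ → (m → m → ℂ) × (Fin D → ℝ) := fun t =>
    (ρ (θ + t • Pi.single k 1), θ + t • Pi.single k 1 - θ)
  have hf : HasDerivAt f (X, Pi.single k 1) 0 := by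
    refine HasDerivAt.prodMk ?_ ?_
    · exact hasDerivAt_pi.mpr fun a => hasDerivAt_pi.mpr fun b => hX a b
    · simp only [add_sub_cancel_left]
      simpa using (hasDerivAt_id (0 : ℝ)).smul_const (Pi.single k 1 : Fin D → ℝ)
  refine mem_of_hasDerivAt_of_eventually_mem V hf ?_
  have hc : Continuous fun t : ℝ => θ + t • (Pi.single k 1 : Fin D → ℝ) := by fun_prop
  have hmem : ∀ᶠ t in nhds (0 : ℝ), θ + t • (Pi.single k 1 : Fin D → ℝ) ∈ Θ :=
    hc.continuousAt.eventually_mem (hΘ.mem_nhds (by simpa using hθ))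
  filter_upwards [hmem] with t ht
  exact Submodule.subset_span ⟨_, ht, rfl⟩

variable [DecidableEq m]

/-- The means of the discretized estimate, differentiated at `θ`, converge to those of the
estimate itself, which form the identity matrix. -/
theorem tendsto_sum_trace_effect_mul {Θ : Set (Fin D → ℝ)} (hΘ : IsOpen Θ)
    {ρ : (Fin D → ℝ) → DensityMatrix m} {Λ : POVM m (Fin D → ℝ)}
    (hub : IsUnbiased Θ fun ϑ => Λ.outcome (ρ ϑ)) {θ : Fin D → ℝ} (hθ : θ ∈ Θ) {k : Fin D}
    {X : Matrix m m ℂ} (hX : HasPartialDeriv (fun ϑ => (ρ ϑ).mat) θ k X) (j : Fin D) :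
    Filter.Tendsto (fun n => ∑ y ∈ (discretize D n).range,
        ((y j - θ j : ℝ) : ℂ) * (Λ.effect (discretize D n ⁻¹' {y}) * X).trace)
      Filter.atTop (nhds (if j = k then 1 else 0)) := by
  -- Both sides are linear in the pair, and unbiasedness gives the claim at the generators.
  have key : ∀ p ∈ Submodule.span ℝ
      ((fun ϑ => ((ρ ϑ).mat, ϑ - θ)) '' Θ : Set (Matrix m m ℂ × (Fin D → ℝ))),
      Filter.Tendsto (fun n => ∑ y ∈ (discretize D n).range,
        ((y j - θ j : ℝ) : ℂ) * (Λ.effect (discretize D n ⁻¹' {y}) * p.1).trace)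
      Filter.atTop (nhds ((p.2 j : ℝ) : ℂ)) := by
    intro p hp
    induction hp using Submodule.span_induction with
    | mem p hp =>
      obtain ⟨ϑ, hϑ, rfl⟩ := hp
      have h1 := tendsto_integral_discretize_sub (fun i => (hub ϑ hϑ i).1) (θ j) j
      rw [(hub ϑ hϑ j).2] at h1
      have h2 := (Complex.continuous_ofReal.tendsto _).comp h1
      refine h2.congr fun n => ?_
      rw [Function.comp_apply, Λ.integral_comp_simpleFunc (ρ ϑ) (discretize D n)
        (fun y => y j - θ j), Complex.ofReal_sum]
      refine Finset.sum_congr rfl fun y _ => ?_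
      rw [Complex.ofReal_mul, trace_mul_ofReal_re
        (Λ.posSemidef _ ((discretize D n).measurableSet_fiber y)).isHermitian
        (ρ ϑ).posSemidef.isHermitian]
    | zero => simp
    | add p q _ _ hp hq =>
      simpa [Matrix.mul_add, mul_add, Finset.sum_add_distrib] using hp.add hq
    | smul t p _ hp =>
      have h := hp.const_mul (t : ℂ)
      simp only [Finset.mul_sum] at h
      simpa [mul_left_comm] using h
  have h := key _ (hX.mem_span hΘ hθ)
  have h1 : (((Pi.single k 1 : Fin D → ℝ) j : ℝ) : ℂ) = if j = k then 1 else 0 := by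
    rw [Pi.single_apply]
    split_ifs <;> simp
  rwa [h1] at h

/-- The Cramér–Rao inequality for a state family of bounded RLD information. -/
theorem one_le_trace_mul_covMatrix_mul {Θ : Set (Fin D → ℝ)} (hΘ : IsOpen Θ)
    {ρ : (Fin D → ℝ) → DensityMatrix m} {Λ : POVM m (Fin D → ℝ)}
    (hub : IsUnbiased Θ fun ϑ => Λ.outcome (ρ ϑ)) {θ : Fin D → ℝ} (hθ : θ ∈ Θ)
    (hL2 : ∀ i, MemLp (fun x : Fin D → ℝ => x i) 2 (Λ.outcome (ρ θ)))
    {C : Matrix (Fin D) (Fin D) ℂ} (hC : (C * Cᴴ).trace = 1) {X : Fin D → Matrix m m ℂ}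
    (hX : ∀ k, HasPartialDeriv (fun ϑ => (ρ ϑ).mat) θ k (X k)) {c : ℝ}
    (hdom : Dominated (ρ θ).mat (combine C X) c) :
    1 ≤ (C * Cᴴ * (covMatrix (Λ.outcome (ρ θ)) θ).map Complex.ofReal).trace.re * c := by
  let E : ℕ → (Fin D → ℝ) → Matrix m m ℂ := fun n y => Λ.effect (discretize D n ⁻¹' {y})
  -- `f l` is the centred estimate paired with the `l`-th column of `C`, so that
  -- `∑ l, ‖f l‖²` has mean `Tr[C Cᴴ Cov]`.
  let f : Fin D → (Fin D → ℝ) → ℂ := fun l y => ∑ j, star (C j l) * ((y j - θ j : ℝ) : ℂ)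
  have hE : ∀ n y, (E n y).PosSemidef := fun n y =>
    Λ.posSemidef _ ((discretize D n).measurableSet_fiber y)
  have hle : ∀ n, ‖∑ l, ∑ y ∈ (discretize D n).range,
      f l y * (E n y * combine C X l).trace‖ ^ 2
      ≤ (∑ l, ∑ y ∈ (discretize D n).range, ‖f l y‖ ^ 2 * (E n y * (ρ θ).mat).trace.re) * c :=
    fun n => hdom.norm_sq_sum_le (discretize D n).range (fun y _ => hE n y)
      (Λ.sum_effect_preimage (discretize D n)) f
  have hleft : Filter.Tendsto (fun n => ∑ l, ∑ y ∈ (discretize D n).range,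
      f l y * (E n y * combine C X l).trace) Filter.atTop (nhds 1) := by
    have h1 : ∀ n, ∑ l, ∑ y ∈ (discretize D n).range, f l y * (E n y * combine C X l).trace
        = ∑ j, ∑ k, (C * Cᴴ) k j • ∑ y ∈ (discretize D n).range,
          ((y j - θ j : ℝ) : ℂ) * (E n y * X k).trace := by
      intro n
      rw [sum_mul_conjTranspose_smul]
      refine Finset.sum_congr rfl fun l _ => ?_
      calc _ = ∑ y ∈ (discretize D n).range, ∑ j, ∑ k, (star (C j l) * C k l) •
            (((y j - θ j : ℝ) : ℂ) * (E n y * X k).trace) := by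
            refine Finset.sum_congr rfl fun y _ => ?_
            simp only [f, combine, Finset.mul_sum, trace_sum, mul_smul_comm, trace_smul,
              smul_eq_mul, Finset.sum_mul]
            rw [Finset.sum_comm]
            exact Finset.sum_congr rfl fun j _ => Finset.sum_congr rfl fun k _ => by ring
        _ = _ := by
            rw [Finset.sum_comm]
            refine Finset.sum_congr rfl fun j _ => ?_
            rw [Finset.sum_comm]
            exact Finset.sum_congr rfl fun k _ => Finset.smul_sum.symm
    simp only [h1]
    have h2 : (1 : ℂ) = ∑ j, ∑ k, (C * Cᴴ) k j • (if j = k then (1 : ℂ) else 0) := by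
      refine hC.symm.trans ?_
      simp [trace]
    rw [h2]
    exact tendsto_finsetSum _ fun j _ => tendsto_finsetSum _ fun k _ =>
      (tendsto_sum_trace_effect_mul hΘ hub hθ (hX k) j).const_smul _
  have hright : Filter.Tendsto (fun n => ∑ l, ∑ y ∈ (discretize D n).range,
      ‖f l y‖ ^ 2 * (E n y * (ρ θ).mat).trace.re) Filter.atTop
      (nhds (C * Cᴴ * (covMatrix (Λ.outcome (ρ θ)) θ).map Complex.ofReal).trace.re) := by
    have h1 : ∀ n, ∑ l, ∑ y ∈ (discretize D n).range,
        ‖f l y‖ ^ 2 * (E n y * (ρ θ).mat).trace.re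
        = (∑ j, ∑ k, (C * Cᴴ) k j • ((∫ x, (discretize D n x j - θ j)
          * (discretize D n x k - θ k) ∂(Λ.outcome (ρ θ)) : ℝ) : ℂ)).re := by
      intro n
      rw [sum_mul_conjTranspose_smul, Complex.re_sum]
      refine Finset.sum_congr rfl fun l _ => ?_
      have h3 : ∀ y : Fin D → ℝ, ((‖f l y‖ ^ 2 : ℝ) : ℂ)
          = ∑ j, ∑ k, (star (C j l) * C k l) • (((y j - θ j) * (y k - θ k) : ℝ) : ℂ) := by
        intro y
        rw [← Complex.normSq_eq_norm_sq, ← Complex.mul_conj, ← Complex.star_def]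
        simp only [f, star_sum, star_mul', starRingEnd_self_apply, Finset.sum_mul_sum,
          Complex.star_def,
          Complex.conj_ofReal, Complex.ofReal_mul, smul_eq_mul]
        exact Finset.sum_congr rfl fun j _ => Finset.sum_congr rfl fun k _ => by ring
      rw [← Complex.ofReal_re (∑ y ∈ (discretize D n).range, _)]
      congr 1
      simp only [Complex.ofReal_sum, Complex.ofReal_mul (‖f l _‖ ^ 2), h3, Finset.sum_mul]
      rw [Finset.sum_comm]
      refine Finset.sum_congr rfl fun j _ => ?_
      rw [Finset.sum_comm]
      refine Finset.sum_congr rfl fun k _ => ?_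
      rw [Λ.integral_comp_simpleFunc (ρ θ) (discretize D n)
        (fun y => (y j - θ j) * (y k - θ k)), Complex.ofReal_sum, Finset.smul_sum]
      refine Finset.sum_congr rfl fun y _ => ?_
      exact (smul_mul_assoc _ _ _).trans (congrArg _ (Complex.ofReal_mul _ _).symm)
    simp only [h1]
    have h2 : (C * Cᴴ * (covMatrix (Λ.outcome (ρ θ)) θ).map Complex.ofReal).trace
        = ∑ j, ∑ k, (C * Cᴴ) k j • ((covMatrix (Λ.outcome (ρ θ)) θ j k : ℝ) : ℂ) := by
      rw [Finset.sum_comm]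
      simp only [trace, diag_apply, mul_apply (M := C * Cᴴ), map_apply, smul_eq_mul]
    rw [h2]
    refine (Complex.continuous_re.tendsto _).comp ?_
    exact tendsto_finsetSum _ fun j _ => tendsto_finsetSum _ fun k _ =>
      ((Complex.continuous_ofReal.tendsto _).comp
        (tendsto_integral_discretize_mul hL2 θ j k)).const_smul _
  have h := le_of_tendsto_of_tendsto' (hleft.norm.pow 2) (hright.mul_const c) hle
  simpa using h

end CramerRao

end QuantumEstimation

theorem mainTheorem1 {D : ℕ} {A B : Type*} [Fintype A] [DecidableEq A] [Fintype B] [DecidableEq B]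
    (Θ : Set (Fin D → ℝ)) (hΘ : IsOpen Θ)
    (N : (Fin D → ℝ) → QuantumEstimation.QuantumChannel A B)
    (hN : QuantumEstimation.IsDifferentiableFamily Θ N)
    (W : Matrix (Fin D) (Fin D) ℂ) (hW : W.PosSemidef) (hW1 : W.trace = 1)
    {n r : ℕ} (S : QuantumEstimation.SequentialScheme A B n r)
    (Λ : QuantumEstimation.POVM (Fin r × B) (Fin D → ℝ))
    (hub : QuantumEstimation.IsUnbiased Θ fun ϑ => Λ.outcome (S.finalState (N ϑ)))
    (θ : Fin D → ℝ) (hθ : θ ∈ Θ)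
    (hL2 : ∀ i, MemLp (fun x : Fin D → ℝ => x i) 2 (Λ.outcome (S.finalState (N θ)))) :
    ((n : ℝ≥0∞) * QuantumEstimation.rldValueChannel W N θ)⁻¹ ≤
      ENNReal.ofReal (W * (QuantumEstimation.covMatrix
        (Λ.outcome (S.finalState (N θ))) θ).map Complex.ofReal).trace.re := by
  have hn : (n : ℝ≥0∞) ≠ 0 := by
    cases S <;> simp
  by_cases htop : QuantumEstimation.rldValueChannel W N θ = ⊤
  · rw [htop, ENNReal.mul_top hn, ENNReal.inv_top]
    exact zero_le
  have hfin : QuantumEstimation.RLDFinite W (fun ϑ => (N ϑ).choi) θ := by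
    by_contra h
    exact htop (by rw [QuantumEstimation.rldValueChannel, if_neg h])
  obtain ⟨C, rfl⟩ := QuantumEstimation.exists_eq_mul_conjTranspose hW
  obtain ⟨X, hX, hdom⟩ := S.finalState_dominated hN hθ C hfin htop
  have h := QuantumEstimation.one_le_trace_mul_covMatrix_mul hΘ hub hθ hL2 hW1 hX hdom
  rw [← one_div]
  refine ENNReal.div_le_of_le_mul ?_
  have hval : (n : ℝ≥0∞) * QuantumEstimation.rldValueChannel (C * C.conjTranspose) N θ
      = ENNReal.ofReal
        (n * (QuantumEstimation.rldValueChannel (C * C.conjTranspose) N θ).toReal) := by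
    rw [ENNReal.ofReal_mul (Nat.cast_nonneg n), ENNReal.ofReal_natCast,
      ENNReal.ofReal_toReal htop]
  rw [hval, ← ENNReal.ofReal_mul' (by positivity)]
  exact ENNReal.one_le_ofReal.mpr h
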